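/- \textbf{Setting.} A \emph{network} is a connected, locally finite multigraph $G=(V,E)$ (loops and multiple edges allowed) with a mark in a complete separable metric space $\Xi$ at every vertex and a mark in a complete separable metric space $\Theta$ at every pair $(v,e)$ of an edge $e$ and an end $v$ of $e$; a \emph{graph} is the case of trivial (one-point) $\Xi$ and $\Theta$. Isomorphisms preserve incidence and all marks. Let $\mathcal G_*=\mathcal G_*(\Xi,\Theta)$ and $\mathcal G_{**}=\mathcal G_{**}(\Xi,\Theta)$ be the sets of isomorphism classes $[G,o]$ of rooted and $[G,o,v]$ of doubly-rooted networks, with the Borel $\sigma$-fields of the local topology (classes are close if the balls of a large radius about the first roots are isomorphic, respecting the roots, with close marks). A random element $[\boldsymbol G,\boldsymbol o]$ of $\mathcal G_*$ is \emph{unimodular} if $\mathbb E\sum_{v\in V(\boldsymbol G)} g[\boldsymbol G,\boldsymbol o,v]=\mathbb E\sum_{v\in V(\boldsymbol G)} g[\boldsymbol G,v,\boldsymbol o]$ for all measurable $g:\mathcal G_{**}\to\mathbb R^{\ge 0}$. An event $A\subseteq\mathcal G_*$ is \emph{invariant} if $[G,o]\in A$ implies $[G,v]\in A$ for every rooted network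 $(G,o)$ and $v\in V(G)$. A unimodular $[\boldsymbol G,\boldsymbol o]$ is \emph{extremal} if every invariant event has probability $0$ or $1$. \textbf{Lemma.} Let $[\boldsymbol G,\boldsymbol o]$ be a unimodular network that is a.s. infinite (in particular, an a.s. infinite unimodular graph). Let $p$ be a Borel probability measure on a complete separable metric space $M$, and let $[\boldsymbol G',\boldsymbol o']$, a random element of $\mathcal G_*(\Xi\times M,\Theta)$ on the same probability space, be obtained from $[\boldsymbol G,\boldsymbol o]$ by adding i.i.d. marks with law $p$ to the vertices; that is, conditionally on $[\boldsymbol G,\boldsymbol o]=[G,o]$, it is distributed as the class of $(G,o)$ with independent additional vertex marks of law $p$. Then for every invariant event $A\subseteq\mathcal G_*(\Xi\times M,\Theta)$, $$\mathbb P\big[[\boldsymbol G',\boldsymbol o']\in A\,\big|\,[\boldsymbol G,\boldsymbol o]\big]\in\{0,1\}\quad\text{a.s.},$$ and the left-hand side does not depend on the root a.s.: it has a version of the form $f[\boldsymbol G,\boldsymbol o]$ with $f:\mathcal G_*(\Xi,\Theta)\to\mathbb R$ measurable, and for every such $f$, a.s. $f[\boldsymbol G,v]=f[\boldsymbol G,\boldsymbol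 o]$ for all $v\in V(\boldsymbol G)$. Moreover, if $[\boldsymbol G,\boldsymbol o]$ is extremal, then $[\boldsymbol G',\boldsymbol o']$ is (unimodular and) extremal and a.s. infinite. -/

import Mathlib

open MeasureTheory ProbabilityTheory Set
open scoped ENNReal NNReal

/-- A (connected, locally finite) network: a multigraph, loops and multiple edges allowed, with
vertex set `V` and edge set `E`, a mark in `Ξ` at every vertex `v` and a mark in `Θ` at every
incident pair `(v, e)`.  Connected locally finite graphs are countable, so vertex and edge
sets in `Type` give all of them up to isomorphism.  A network with a single mark space
is the case `Ξ = Θ`, a graph without marks is the case `Ξ = Θ = Unit`. -/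
structure Network (Ξ Θ : Type*) where
  V : Type
  E : Type
  /-- the end vertices of an edge (equal for a loop) -/
  ends : E → Sym2 V
  vmark : V → Ξ
  emark : (e : E) → (v : V) → v ∈ ends e → Θ
  connected : (SimpleGraph.fromRel (fun u v : V => ∃ e, ends e = s(u, v))).Connected
  locallyFinite : ∀ v : V, {e : E | v ∈ ends e}.Finite

namespace Network

variable {Ξ Θ M : Type*}

/-- The simple graph with the same vertices and the same adjacency of distinct vertices, which
carries the graph distance. -/
def skeleton (G : Network Ξ Θ) : SimpleGraph G.V :=
  SimpleGraph.fromRel (fun u v => ∃ e, G.ends e = s(u, v))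

/-- The closed ball of radius `r` about `o` in the graph distance. -/
def ball (G : Network Ξ Θ) (o : G.V) (r : ℕ) : Set G.V := {v | G.skeleton.dist o v ≤ r}

/-- The edges of the subgraph induced on the ball: all their ends lie in the ball. -/
def ballEdges (G : Network Ξ Θ) (o : G.V) (r : ℕ) : Set G.E :=
  {e | ∀ v ∈ G.ends e, v ∈ G.ball o r}

theorem root_mem_ball (G : Network Ξ Θ) (o : G.V) (r : ℕ) : o ∈ G.ball o r := by
  simp [ball]

/-- Isomorphisms of networks: bijections of the vertices and of the edges that preserve incidence
and all the marks. -/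
structure Iso (G H : Network Ξ Θ) where
  vMap : G.V ≃ H.V
  eMap : G.E ≃ H.E
  mem_ends : ∀ e v, v ∈ G.ends e ↔ vMap v ∈ H.ends (eMap e)
  vmark_eq : ∀ v, H.vmark (vMap v) = G.vmark v
  emark_eq : ∀ e v (h : v ∈ G.ends e),
    H.emark (eMap e) (vMap v) ((mem_ends e v).1 h) = G.emark e v h

def Iso.refl (G : Network Ξ Θ) : Iso G G where
  vMap := Equiv.refl _
  eMap := Equiv.refl _
  mem_ends _ _ := Iff.rfl
  vmark_eq _ := rfl
  emark_eq _ _ _ := rfl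

theorem emark_congr (G : Network Ξ Θ) {e e' : G.E} {v v' : G.V} (he : e = e') (hv : v = v')
    (h : v ∈ G.ends e) (h' : v' ∈ G.ends e') : G.emark e v h = G.emark e' v' h' := by
  subst he hv; rfl

def Iso.symm {G H : Network Ξ Θ} (φ : Iso G H) : Iso H G where
  vMap := φ.vMap.symm
  eMap := φ.eMap.symm
  mem_ends e v := by rw [φ.mem_ends]; simp
  vmark_eq v := by rw [← φ.vmark_eq]; simp
  emark_eq e v h := by
    rw [← φ.emark_eq]
    exact H.emark_congr (by simp) (by simp) _ _

def Iso.trans {G H K : Network Ξ Θ} (φ : Iso G H) (ψ : Iso H K) : Iso G K where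
  vMap := φ.vMap.trans ψ.vMap
  eMap := φ.eMap.trans ψ.eMap
  mem_ends e v := by rw [φ.mem_ends, ψ.mem_ends]; rfl
  vmark_eq v := by rw [← φ.vmark_eq, ← ψ.vmark_eq]; rfl
  emark_eq e v h := by
    rw [← φ.emark_eq, ← ψ.emark_eq]; rfl

/-- Rooted isomorphisms of the balls of radius `r` (as induced subgraphs, marks ignored). -/
structure BallIso (G H : Network Ξ Θ) (o : G.V) (p : H.V) (r : ℕ) where
  vMap : G.ball o r ≃ H.ball p r
  eMap : G.ballEdges o r ≃ H.ballEdges p r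
  map_root : vMap ⟨o, G.root_mem_ball o r⟩ = ⟨p, H.root_mem_ball p r⟩
  mem_ends : ∀ (e : G.ballEdges o r) (v : G.ball o r),
    (v : G.V) ∈ G.ends e ↔ (vMap v : H.V) ∈ H.ends (eMap e)

/-- Corresponding marks in the two balls are at distance less than `ε`. -/
def BallIso.MarksWithin [MetricSpace Ξ] [MetricSpace Θ] {G H : Network Ξ Θ} {o : G.V} {p : H.V} {r : ℕ}
    (φ : BallIso G H o p r) (ε : ℝ) : Prop :=
  (∀ v : G.ball o r, dist (G.vmark v) (H.vmark (φ.vMap v)) < ε) ∧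
  ∀ (e : G.ballEdges o r) (v : G.ball o r) (h : (v : G.V) ∈ G.ends e),
    dist (G.emark e v h) (H.emark (φ.eMap e) (φ.vMap v) ((φ.mem_ends e v).1 h)) < ε

/-- Add the additional marks `m` to the vertices of `G`; existing marks are kept. -/
def addMarks (G : Network Ξ Θ) (m : G.V → M) : Network (Ξ × M) Θ where
  V := G.V
  E := G.E
  ends := G.ends
  vmark v := (G.vmark v, m v)
  emark := G.emark
  connected := G.connected
  locallyFinite := G.locallyFinite

end Network

structure RootedNetwork (Ξ Θ : Type*) extends Network Ξ Θ where
  root : V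

structure DoublyRootedNetwork (Ξ Θ : Type*) extends Network Ξ Θ where
  root : V
  root' : V

section Classes

variable {Ξ Θ : Type*}

instance rootedSetoid (Ξ Θ : Type*) : Setoid (RootedNetwork Ξ Θ) where
  r R S := ∃ φ : Network.Iso R.toNetwork S.toNetwork, φ.vMap R.root = S.root
  iseqv := {
    refl := fun R => ⟨Network.Iso.refl _, rfl⟩
    symm := fun ⟨φ, h⟩ => ⟨φ.symm, by rw [← h]; simp [Network.Iso.symm]⟩
    trans := fun ⟨φ, h⟩ ⟨ψ, h'⟩ => ⟨φ.trans ψ, by rw [← h', ← h]; rfl⟩ }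

instance doublyRootedSetoid (Ξ Θ : Type*) : Setoid (DoublyRootedNetwork Ξ Θ) where
  r R S := ∃ φ : Network.Iso R.toNetwork S.toNetwork,
    φ.vMap R.root = S.root ∧ φ.vMap R.root' = S.root'
  iseqv := {
    refl := fun R => ⟨Network.Iso.refl _, rfl, rfl⟩
    symm := fun ⟨φ, h, k⟩ => ⟨φ.symm, by rw [← h]; simp [Network.Iso.symm],
      by rw [← k]; simp [Network.Iso.symm]⟩
    trans := fun ⟨φ, h, k⟩ ⟨ψ, h', k'⟩ =>
      ⟨φ.trans ψ, by rw [← h', ← h]; rfl, by rw [← k', ← k]; rfl⟩ }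

/-- The space `𝒢_*` of isomorphism classes of rooted networks. -/
def GStar (Ξ Θ : Type*) := Quotient (rootedSetoid Ξ Θ)

/-- The space `𝒢_**` of isomorphism classes of doubly-rooted networks. -/
def GStarStar (Ξ Θ : Type*) := Quotient (doublyRootedSetoid Ξ Θ)

/-- The class `[G, o]`. -/
def GStar.mk (G : Network Ξ Θ) (o : G.V) : GStar Ξ Θ :=
  Quotient.mk (rootedSetoid Ξ Θ) ⟨G, o⟩

/-- The class `[G, o, v]`. -/
def GStarStar.mk (G : Network Ξ Θ) (o v : G.V) : GStarStar Ξ Θ :=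
  Quotient.mk (doublyRootedSetoid Ξ Θ) ⟨G, o, v⟩

theorem GStar.mk_eq {G H : Network Ξ Θ} (φ : Network.Iso G H) (o : G.V) :
    GStar.mk G o = GStar.mk H (φ.vMap o) :=
  Quotient.sound ⟨φ, rfl⟩

theorem GStarStar.mk_eq {G H : Network Ξ Θ} (φ : Network.Iso G H) (o v : G.V) :
    GStarStar.mk G o v = GStarStar.mk H (φ.vMap o) (φ.vMap v) :=
  Quotient.sound ⟨φ, rfl, rfl⟩

/-- The basic neighbourhood of `[G, o]`: the classes `[H, p]` for which the balls of radius `r`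
about the roots are isomorphic with marks `ε`-close. -/
def GStar.nhd [MetricSpace Ξ] [MetricSpace Θ] (G : Network Ξ Θ) (o : G.V) (r : ℕ) (ε : ℝ) :
    Set (GStar Ξ Θ) :=
  {y | ∃ (H : Network Ξ Θ) (p : H.V), y = GStar.mk H p ∧
    ∃ φ : Network.BallIso G H o p r, φ.MarksWithin ε}

/-- The basic neighbourhood of `[G, o, v]`, nonempty once `r` is so large that the ball about the
first root contains the second root. -/
def GStarStar.nhd [MetricSpace Ξ] [MetricSpace Θ] (G : Network Ξ Θ) (o v : G.V) (r : ℕ) (ε : ℝ) :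
    Set (GStarStar Ξ Θ) :=
  {y | ∃ (H : Network Ξ Θ) (p w : H.V), y = GStarStar.mk H p w ∧
    ∃ φ : Network.BallIso G H o p r, φ.MarksWithin ε ∧
      ∃ h : v ∈ G.ball o r, (φ.vMap ⟨v, h⟩ : H.V) = w}

/-- The topology of local convergence of rooted networks. It is the topology of the usual metric
in which two classes are at distance `1 / (1 + s)`, where `s` is the supremum of the `r` such
that the balls of radius `⌊r⌋` about the roots are isomorphic with marks `1 / r`-close. -/
instance [MetricSpace Ξ] [MetricSpace Θ] : TopologicalSpace (GStar Ξ Θ) :=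
  TopologicalSpace.generateFrom
    {U | ∃ (G : Network Ξ Θ) (o : G.V) (r : ℕ) (ε : ℝ), 0 < ε ∧ U = GStar.nhd G o r ε}

instance [MetricSpace Ξ] [MetricSpace Θ] : TopologicalSpace (GStarStar Ξ Θ) :=
  TopologicalSpace.generateFrom
    {U | ∃ (G : Network Ξ Θ) (o v : G.V) (r : ℕ) (ε : ℝ), 0 < ε ∧ U = GStarStar.nhd G o v r ε}

instance [MetricSpace Ξ] [MetricSpace Θ] : MeasurableSpace (GStar Ξ Θ) := borel _
instance [MetricSpace Ξ] [MetricSpace Θ] : BorelSpace (GStar Ξ Θ) := ⟨rfl⟩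
instance [MetricSpace Ξ] [MetricSpace Θ] : MeasurableSpace (GStarStar Ξ Θ) := borel _
instance [MetricSpace Ξ] [MetricSpace Θ] : BorelSpace (GStarStar Ξ Θ) := ⟨rfl⟩

/-- `g⁺_G(o) = ∑_v g[G, o, v]`. -/
noncomputable def massOut (g : GStarStar Ξ Θ → ℝ≥0) : GStar Ξ Θ → ℝ≥0∞ :=
  Quotient.lift (fun R : RootedNetwork Ξ Θ =>
      ∑' v : R.V, (g (GStarStar.mk R.toNetwork R.root v) : ℝ≥0∞)) (by
    rintro R S ⟨φ, h⟩
    rw [← φ.vMap.tsum_eq, ← h]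
    exact tsum_congr fun v => by rw [GStarStar.mk_eq φ])

/-- `g⁻_G(o) = ∑_v g[G, v, o]`. -/
noncomputable def massIn (g : GStarStar Ξ Θ → ℝ≥0) : GStar Ξ Θ → ℝ≥0∞ :=
  Quotient.lift (fun R : RootedNetwork Ξ Θ =>
      ∑' v : R.V, (g (GStarStar.mk R.toNetwork v R.root) : ℝ≥0∞)) (by
    rintro R S ⟨φ, h⟩
    rw [← φ.vMap.tsum_eq, ← h]
    exact tsum_congr fun v => by rw [GStarStar.mk_eq φ])

/-- Unimodular probability measures on `𝒢_*` (mass transport principle). -/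
def IsUnimodular [MetricSpace Ξ] [MetricSpace Θ] (μ : Measure (GStar Ξ Θ)) : Prop :=
  IsProbabilityMeasure μ ∧
    ∀ g : GStarStar Ξ Θ → ℝ≥0, Measurable g → ∫⁻ x, massOut g x ∂μ = ∫⁻ x, massIn g x ∂μ

/-- Events of `𝒢_*` that are invariant under changing the root. -/
def IsInvariantEvent [MetricSpace Ξ] [MetricSpace Θ] (A : Set (GStar Ξ Θ)) : Prop :=
  MeasurableSet A ∧
    ∀ (G : Network Ξ Θ) (o v : G.V), GStar.mk G o ∈ A → GStar.mk G v ∈ A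

/-- Extremal unimodular probability measures. -/
def IsExtremal [MetricSpace Ξ] [MetricSpace Θ] (μ : Measure (GStar Ξ Θ)) : Prop :=
  IsUnimodular μ ∧ ∀ A, IsInvariantEvent A → μ A = 0 ∨ μ A = 1

/-- The network of the class `x` has infinitely many vertices. -/
def GStar.IsInfinite (x : GStar Ξ Θ) : Prop :=
  ∀ (G : Network Ξ Θ) (o : G.V), GStar.mk G o = x → Infinite G.V

/-- `f` takes the same value at `x = [G, o]` and at all `[G, v]`, `v ∈ V(G)`. -/
def RootIndependentAt (f : GStar Ξ Θ → ℝ) (x : GStar Ξ Θ) : Prop :=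
  ∀ (G : Network Ξ Θ) (o : G.V), GStar.mk G o = x → ∀ v : G.V, f (GStar.mk G v) = f x

end Classes

section Marking

variable {Ξ Θ M : Type*} [MeasurableSpace M]

def Network.Iso.addMarks {G H : Network Ξ Θ} (φ : Network.Iso G H) (m : H.V → M) :
    Network.Iso (G.addMarks (m ∘ φ.vMap)) (H.addMarks m) where
  vMap := φ.vMap
  eMap := φ.eMap
  mem_ends := φ.mem_ends
  vmark_eq v := Prod.ext (φ.vmark_eq v) rfl
  emark_eq := φ.emark_eq

/-- The law of the class of `(G, o)` after adding independent marks with common law `p` to the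
vertices. -/
noncomputable def markLawAt [MetricSpace Ξ] [MetricSpace Θ] [MetricSpace M] (p : Measure M) [IsProbabilityMeasure p]
    (G : Network Ξ Θ) (o : G.V) : Measure (GStar (Ξ × M) Θ) :=
  (Measure.infinitePi (fun _ : G.V => p)).map (fun m => GStar.mk (G.addMarks m) o)

theorem markLawAt_congr [MetricSpace Ξ] [MetricSpace Θ] [MetricSpace M] (p : Measure M) [IsProbabilityMeasure p]
    {G H : Network Ξ Θ} (φ : Network.Iso G H) (o : G.V) :
    markLawAt p G o = markLawAt p H (φ.vMap o) := by
  set e : (H.V → M) ≃ᵐ (G.V → M) :=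
    MeasurableEquiv.piCongrLeft (fun _ : G.V => M) φ.vMap.symm with he
  have hmap : (Measure.infinitePi (fun _ : H.V => p)).map e =
      Measure.infinitePi (fun _ : G.V => p) :=
    Measure.infinitePi_map_piCongrLeft (X := fun _ : G.V => M) (fun _ => p) φ.vMap.symm
  have hcomp : (fun m : H.V → M => GStar.mk (H.addMarks m) (φ.vMap o)) =
      (fun m : G.V → M => GStar.mk (G.addMarks m) o) ∘ e := by
    funext m
    have hm : e m = m ∘ φ.vMap := by
      funext v
      have := Equiv.piCongrLeft_apply_apply (fun _ : G.V => M) φ.vMap.symm m (φ.vMap v)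
      simpa [he, MeasurableEquiv.coe_piCongrLeft] using this
    rw [Function.comp_apply, hm]
    exact (GStar.mk_eq (φ.addMarks m) o).symm
  unfold markLawAt
  rw [hcomp]
  by_cases h : AEMeasurable (fun m : G.V → M => GStar.mk (G.addMarks m) o)
      (Measure.infinitePi (fun _ : G.V => p))
  · rw [← hmap] at h ⊢
    exact h.map_map_of_aemeasurable e.measurable.aemeasurable
  · rw [Measure.map_of_not_aemeasurable h, Measure.map_of_not_aemeasurable]
    rwa [← e.measurableEmbedding.aemeasurable_map_iff, hmap]

/-- The conditional law of `[G', o']` given that `[G, o]` is the class `x`. -/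
noncomputable def markLaw [MetricSpace Ξ] [MetricSpace Θ] [MetricSpace M] (p : Measure M) [IsProbabilityMeasure p] :
    GStar Ξ Θ → Measure (GStar (Ξ × M) Θ) :=
  Quotient.lift (fun R : RootedNetwork Ξ Θ => markLawAt p R.toNetwork R.root) (by
    rintro R S ⟨φ, h⟩
    rw [← h]
    exact markLawAt_congr p φ R.root)

/-- The random rooted network `X'`, defined on the same probability space as `X`, arises from `X` by
adding i.i.d. marks with law `p` to the vertices: given `X = [G, o]`, the class `X'` is distributed
as `[G, o]` with independent marks of law `p` added. -/
def IsIIDMarking [MetricSpace Ξ] [MetricSpace Θ] [MetricSpace M] (p : Measure M) [IsProbabilityMeasure p]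
    {Ω : Type*} [MeasurableSpace Ω] (P : Measure Ω)
    (X : Ω → GStar Ξ Θ) (X' : Ω → GStar (Ξ × M) Θ) : Prop :=
  Measurable X ∧ Measurable X' ∧
    ∀ (B : Set (GStar Ξ Θ)) (A : Set (GStar (Ξ × M) Θ)), MeasurableSet B → MeasurableSet A →
      P (X ⁻¹' B ∩ X' ⁻¹' A) = ∫⁻ ω in X ⁻¹' B, markLaw p (X ω) A ∂P

end Marking

namespace Network

variable {Ξ Θ M : Type*}

theorem finite_ball (G : Network Ξ Θ) (o : G.V) (r : ℕ) : (G.ball o r).Finite := by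
  have hconn : G.skeleton.Connected := G.connected
  induction r generalizing o with
  | zero =>
    refine (Set.finite_singleton o).subset fun v hv => ?_
    have h0 : G.skeleton.dist o v = 0 := Nat.le_zero.1 hv
    exact ((hconn.dist_eq_zero_iff).1 h0).symm
  | succ r ih =>
    have hN : {u : G.V | ∃ e, o ∈ G.ends e ∧ u ∈ G.ends e}.Finite := by
      refine ((G.locallyFinite o).biUnion (t := fun e => {u | u ∈ G.ends e})
        fun e _ => ?_).subset ?_
      · induction h : G.ends e with
        | _ a b => exact (Set.toFinite {a, b}).subset fun u hu => by simpa using hu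
      · rintro u ⟨e, he, hu⟩
        exact Set.mem_biUnion (show e ∈ {e | o ∈ G.ends e} from he) hu
    refine ((Set.finite_singleton o).union (hN.biUnion fun u _ => ih u)).subset fun v hv => ?_
    obtain ⟨w, hw⟩ := hconn.exists_walk_length_eq_dist o v
    have hle : w.length ≤ r + 1 := hw ▸ hv
    cases w with
    | nil => exact Or.inl rfl
    | @cons _ u _ hadj w =>
      refine Or.inr (Set.mem_biUnion (x := u) ?_ ?_)
      · rcases (SimpleGraph.fromRel_adj _ _ _).1 hadj with ⟨_, ⟨e, he⟩ | ⟨e, he⟩⟩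
        · exact ⟨e, by simp [he], by simp [he]⟩
        · exact ⟨e, by simp [he], by simp [he]⟩
      · have : G.skeleton.dist u v ≤ w.length := SimpleGraph.dist_le w
        simp only [SimpleGraph.Walk.length_cons] at hle
        exact this.trans (by omega)

theorem countable_V (G : Network Ξ Θ) : Countable G.V := by
  obtain ⟨o⟩ := G.connected.nonempty
  have : (⋃ r : ℕ, G.ball o r) = Set.univ :=
    Set.eq_univ_of_forall fun v => Set.mem_iUnion.2 ⟨_, le_refl (G.skeleton.dist o v)⟩
  rw [← Set.countable_univ_iff, ← this]
  exact Set.countable_iUnion fun r => (G.finite_ball o r).countable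

theorem Iso.skeleton_adj {G H : Network Ξ Θ} (φ : Iso G H) (u v : G.V) :
    H.skeleton.Adj (φ.vMap u) (φ.vMap v) ↔ G.skeleton.Adj u v := by
  have key : ∀ {K : Network Ξ Θ} (a b : K.V),
      K.skeleton.Adj a b ↔ a ≠ b ∧ ∃ e, a ∈ K.ends e ∧ b ∈ K.ends e := by
    intro K a b
    unfold skeleton
    rw [SimpleGraph.fromRel_adj]
    refine and_congr_right fun hab => ⟨?_, ?_⟩
    · rintro (⟨e, he⟩ | ⟨e, he⟩)
      · exact ⟨e, by simp [he], by simp [he]⟩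
      · exact ⟨e, by simp [he], by simp [he]⟩
    · rintro ⟨e, ha, hb⟩
      exact Or.inl ⟨e, (Sym2.mem_and_mem_iff hab).1 ⟨ha, hb⟩⟩
  rw [key, key]
  refine and_congr φ.vMap.injective.ne_iff ⟨?_, ?_⟩
  · rintro ⟨e, hu, hv⟩
    refine ⟨φ.eMap.symm e, ?_, ?_⟩ <;> rw [φ.mem_ends] <;> simpa
  · rintro ⟨e, hu, hv⟩
    exact ⟨φ.eMap e, (φ.mem_ends _ _).1 hu, (φ.mem_ends _ _).1 hv⟩

theorem Iso.dist_eq {G H : Network Ξ Θ} (φ : Iso G H) (u v : G.V) :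
    H.skeleton.dist (φ.vMap u) (φ.vMap v) = G.skeleton.dist u v := by
  have main : ∀ {G H : Network Ξ Θ} (φ : Iso G H) (u v : G.V),
      H.skeleton.dist (φ.vMap u) (φ.vMap v) ≤ G.skeleton.dist u v := by
    intro G H φ u v
    have hconn : G.skeleton.Connected := G.connected
    obtain ⟨w, hw⟩ := hconn.exists_walk_length_eq_dist u v
    let f : G.skeleton →g H.skeleton := ⟨φ.vMap, fun {a b} h => (φ.skeleton_adj a b).2 h⟩
    rw [← hw, ← SimpleGraph.Walk.length_map f w]
    exact SimpleGraph.dist_le _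
  refine le_antisymm (main φ u v) ?_
  have := main φ.symm (φ.vMap u) (φ.vMap v)
  simpa [Iso.symm] using this

theorem Iso.mem_ball {G H : Network Ξ Θ} (φ : Iso G H) (o : G.V) (r : ℕ) (v : G.V) :
    v ∈ G.ball o r ↔ φ.vMap v ∈ H.ball (φ.vMap o) r := by
  simp [ball, φ.dist_eq]

theorem Iso.mem_ballEdges {G H : Network Ξ Θ} (φ : Iso G H) (o : G.V) (r : ℕ) (e : G.E) :
    e ∈ G.ballEdges o r ↔ φ.eMap e ∈ H.ballEdges (φ.vMap o) r := by
  constructor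
  · intro h v hv
    have := h (φ.vMap.symm v) (by rw [φ.mem_ends]; simpa)
    rw [φ.mem_ball] at this
    simpa using this
  · intro h v hv
    rw [φ.mem_ball]
    exact h _ ((φ.mem_ends _ _).1 hv)

/-- Compose an isomorphism of balls with an isomorphism of networks. -/
def BallIso.trans {G H K : Network Ξ Θ} {o : G.V} {p : H.V} {r : ℕ} (φ : BallIso G H o p r)
    (ψ : Iso H K) : BallIso G K o (ψ.vMap p) r where
  vMap := φ.vMap.trans (ψ.vMap.subtypeEquiv (ψ.mem_ball p r))
  eMap := φ.eMap.trans (ψ.eMap.subtypeEquiv (ψ.mem_ballEdges p r))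
  map_root := by simp [φ.map_root]
  mem_ends e v := by rw [φ.mem_ends, ψ.mem_ends]; rfl

theorem BallIso.MarksWithin.trans [MetricSpace Ξ] [MetricSpace Θ] {G H K : Network Ξ Θ} {o : G.V} {p : H.V}
    {r : ℕ} {φ : BallIso G H o p r} {ε : ℝ} (h : φ.MarksWithin ε) (ψ : Iso H K) :
    (φ.trans ψ).MarksWithin ε := by
  refine ⟨fun v => ?_, fun e v hv => ?_⟩
  · have := h.1 v
    rwa [← ψ.vmark_eq] at this
  · have := h.2 e v hv
    rwa [← ψ.emark_eq] at this

end Network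

theorem GStar.mk_mem_nhd {Ξ Θ : Type*} [MetricSpace Ξ] [MetricSpace Θ] {G H : Network Ξ Θ} {o : G.V}
    {p : H.V} {r : ℕ} {ε : ℝ} : GStar.mk H p ∈ GStar.nhd G o r ε ↔
      ∃ φ : Network.BallIso G H o p r, φ.MarksWithin ε := by
  constructor
  · rintro ⟨H', p', hy, φ, hφ⟩
    obtain ⟨ψ, hψ⟩ := Quotient.exact hy.symm
    have key : ∀ (ψ : Network.Iso H' H) (q : H.V), ψ.vMap p' = q →
        ∃ φ : Network.BallIso G H o q r, φ.MarksWithin ε := by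
      rintro ψ _ rfl
      exact ⟨φ.trans ψ, hφ.trans ψ⟩
    exact key ψ p hψ
  · exact fun h => ⟨H, p, rfl, h⟩

/-- The class of the marked network depends measurably on the marks. -/
theorem measurable_mk_addMarks {Ξ Θ M : Type*} [MetricSpace Ξ] [MetricSpace Θ] [MetricSpace M]
    [TopologicalSpace.SeparableSpace M] [MeasurableSpace M] [BorelSpace M]
    (G : Network Ξ Θ) (o : G.V) :
    Measurable (fun m : G.V → M => GStar.mk (G.addMarks m) o) := by
  have : Countable G.V := G.countable_V
  have : SecondCountableTopology M := UniformSpace.secondCountable_of_separable M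
  refine Continuous.measurable (continuous_generateFrom_iff.2 ?_)
  rintro _ ⟨H, p, r, ε, -, rfl⟩
  rw [isOpen_iff_mem_nhds]
  intro m hm
  obtain ⟨φ, hφ⟩ := GStar.mk_mem_nhd.1 hm
  have : Finite (H.ball p r) := H.finite_ball p r
  have hev : ∀ᶠ m' : G.V → M in nhds m, ∀ v : H.ball p r,
      dist (H.vmark v).2 (m' (φ.vMap v).1) < ε := by
    refine Filter.eventually_all.2 fun v => ?_
    have hc : Continuous fun m' : G.V → M => dist (H.vmark v).2 (m' (φ.vMap v).1) := by
      fun_prop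
    refine hc.continuousAt.eventually_lt continuousAt_const ?_
    exact lt_of_le_of_lt (le_max_right _ _) (hφ.1 v)
  filter_upwards [hev] with m' hm'
  refine GStar.mk_mem_nhd.2
    ⟨(⟨φ.vMap, φ.eMap, φ.map_root, φ.mem_ends⟩ : Network.BallIso H (G.addMarks m') p o r),
      fun v => ?_, hφ.2⟩
  exact max_lt (lt_of_le_of_lt (le_max_left _ _) (hφ.1 v)) (hm' v)

/-! Fix an invariant event `A`. Given the network, let `q` be the probability of `A` under i.i.d.
marks; by invariance it does not depend on the root. For a vertex `u` and a radius `r`, let the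
defect be the probability that resampling all marks outside the `r`-ball about `u` changes whether
`A` occurs. Approximation by cylinders makes the defect arbitrarily small for suitable `r`
(`exists_resampleDefect_lt`). If the `r`-balls about `u` and `v` are disjoint, then `A` is almost
determined by each of two independent families of marks, so it is almost independent of itself: `q
(1 - q)` is at most the defect at `u` plus twice the defect at `v` (`mul_compl_le_resampleDefect`).

Hence the vertices whose defect is below `q (1 - q) / 3` are within `2 r` of each other, and there
are finitely many. By mass transport an infinite unimodular network a.s. does not have its root in
such a finite set (`IsUnimodular.ae_notMem_of_finite`). This holds for all `r` at once, while `q (1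
- q) > 0` would put the root in the set for some `r`. So `q` is `0` or `1`
(`IsUnimodular.ae_markLaw_zero_or_one`).

Extremality follows: `{q = 1}` is an invariant event of the unmarked network with the same
probability as `A`. Unimodularity passes to the marked network because adding marks commutes with
choosing a second root. Measurability of the kernels involved comes from lower semicontinuity of
their values on open sets, which form a π-system. -/

/-! ### Resampling i.i.d. marks on a fixed vertex set. -/

section ProductMarks

variable {V M : Type*} [MeasurableSpace M]

/-- Both sides are images of an i.i.d. family indexed by pairs of a vertex and a Boolean, curried in
the two possible orders. -/
theorem infinitePi_prod_map_unzip (p : Measure M) [IsProbabilityMeasure p] :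
    (Measure.infinitePi fun _ : V => p.prod p).map
        (fun m => ((fun x => (m x).1 : V → M), (fun x => (m x).2 : V → M))) =
      (Measure.infinitePi fun _ : V => p).prod (Measure.infinitePi fun _ : V => p) := by
  have h1 : (Measure.infinitePi fun _ : V × Bool => p).map
      (fun ω x => (ω (x, true), ω (x, false))) = Measure.infinitePi fun _ : V => p.prod p := by
    have hp : (Measure.infinitePi fun _ : Bool => p).map (fun ω => (ω true, ω false)) =
        p.prod p := Measure.infinitePi_map_eval_prod (P := fun _ : Bool => p) (by decide)
    rw [← hp, ← Measure.infinitePi_map_pi (X := fun _ : V => Bool → M)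
        (fun _ => Measure.infinitePi fun _ : Bool => p)
        (f := fun _ (ω : Bool → M) => (ω true, ω false)) (fun _ => by fun_prop),
      ← Measure.infinitePi_map_curry (fun (_ : V) (_ : Bool) => p),
      Measure.map_map (by fun_prop) (by fun_prop)]
    rfl
  have h2 : (Measure.infinitePi fun _ : Bool × V => p).map
      (fun ω => ((fun x => ω (true, x) : V → M), (fun x => ω (false, x) : V → M))) =
      (Measure.infinitePi fun _ : V => p).prod (Measure.infinitePi fun _ : V => p) := by
    rw [← Measure.infinitePi_map_eval_prod
        (P := fun _ : Bool => Measure.infinitePi fun _ : V => p) (i := true) (j := false)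
        (by decide),
      ← Measure.infinitePi_map_curry (fun (_ : Bool) (_ : V) => p),
      Measure.map_map (by fun_prop) (by fun_prop)]
    rfl
  have h3 : (Measure.infinitePi fun _ : V × Bool => p).map (fun ω i => ω (Prod.swap i)) =
      Measure.infinitePi fun _ : Bool × V => p :=
    Measure.map_infinitePi_infinitePi_of_inj (P := fun _ : V × Bool => p)
      (f := (Prod.swap : Bool × V → V × Bool)) Prod.swap_injective
  rw [← h1, ← h2, ← h3, Measure.map_map (by fun_prop) (by fun_prop),
    Measure.map_map (by fun_prop) (by fun_prop)]
  rfl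

open Classical in
/-- The first of two configurations on `B`, the second one off `B`. -/
noncomputable def mixMarks (B : Set V) (m : V → M × M) : V → M :=
  fun x => if x ∈ B then (m x).1 else (m x).2

theorem measurable_mixMarks (B : Set V) : Measurable (mixMarks (M := M) B) := by
  refine measurable_pi_lambda _ fun x => ?_
  unfold mixMarks
  split_ifs <;> fun_prop

omit [MeasurableSpace M] in
theorem mixMarks_univ (m : V → M × M) : mixMarks univ m = fun x => (m x).1 := by
  funext x; simp [mixMarks]

/-- The probability that resampling the marks off `B` affects the event `A`. -/
noncomputable def resampleDefect (p : Measure M) [IsProbabilityMeasure p] (A : Set (V → M))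
    (B : Set V) : ℝ≥0∞ :=
  Measure.infinitePi (fun _ : V => p.prod p)
    (symmDiff (mixMarks univ ⁻¹' A) (mixMarks B ⁻¹' A))

theorem map_mixMarks (p : Measure M) [IsProbabilityMeasure p] (B : Set V) :
    (Measure.infinitePi fun _ : V => p.prod p).map (mixMarks B) =
      Measure.infinitePi fun _ : V => p := by
  classical
  have := Measure.infinitePi_map_pi (X := fun _ : V => M × M) (fun _ => p.prod p)
    (f := fun x y => if x ∈ B then y.1 else y.2)
    (fun x => by split_ifs <;> fun_prop)
  convert this using 2
  · funext m x; rfl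
  · funext x
    split_ifs
    · exact Measure.fst_prod.symm
    · exact Measure.snd_prod.symm

/-- Take independent configurations `X`, `Y`, `Z`, and let `W` be `X` on `B` and `Y` off `B`. As `W
= Y` on `C`, replacing the marks off `C` by those of `Z` turns `W` and `Y` into the same
configuration. If `X ∈ A` and `Y ∉ A`, membership changes somewhere along `X`, `W`, this common
configuration, `Y`; the first step costs the defect of `B`, each of the other two the defect of `C`.
-/
theorem mul_compl_le_resampleDefect (p : Measure M) [IsProbabilityMeasure p] {A : Set (V → M)}
    (hA : MeasurableSet A) {B C : Set V} (hBC : Disjoint B C) :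
    Measure.infinitePi (fun _ : V => p) A * Measure.infinitePi (fun _ : V => p) Aᶜ ≤
      resampleDefect p A B + 2 * resampleDefect p A C := by
  classical
  set μ := Measure.infinitePi fun _ : V => p.prod p with hμ
  set ν := Measure.infinitePi fun _ : V => p.prod (p.prod p) with hν
  have h12 : (p.prod (p.prod p)).map (fun y => (y.1, y.2.1)) = p.prod p := by
    have := Measure.map_prod_map p (p.prod p) measurable_id
      (measurable_fst : Measurable (Prod.fst : M × M → M))
    rw [Measure.map_id, ← Measure.fst, Measure.fst_prod] at this
    exact this.symm
  have h13 : (p.prod (p.prod p)).map (fun y => (y.1, y.2.2)) = p.prod p := by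
    have := Measure.map_prod_map p (p.prod p) measurable_id
      (measurable_snd : Measurable (Prod.snd : M × M → M))
    rw [Measure.map_id, ← Measure.snd, Measure.snd_prod] at this
    exact this.symm
  have h23 : (p.prod (p.prod p)).map (fun y => (y.2.1, y.2.2)) = p.prod p :=
    Measure.snd_prod
  have hind : Measure.infinitePi (fun _ : V => p) A * Measure.infinitePi (fun _ : V => p) Aᶜ =
      μ {m | (fun x => (m x).1) ∈ A ∧ (fun x => (m x).2) ∉ A} := by
    rw [← Measure.prod_prod, ← infinitePi_prod_map_unzip, Measure.map_apply (by fun_prop)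
      (hA.prod hA.compl)]
    rfl
  -- The coordinates of `w` are the triples `(X, Y, Z)`. A pair built from them vertex by vertex,
  -- with law `p.prod p` at each vertex, is again an i.i.d. pair of configurations.
  have hpush : ∀ f : V → M × (M × M) → M × M, (∀ x, Measurable (f x)) →
      (∀ x, (p.prod (p.prod p)).map (f x) = p.prod p) → ∀ S : Set (V → M × M),
      MeasurableSet S → μ S = ν {w | (fun x => f x (w x)) ∈ S} := by
    intro f hf hfp S hS
    have := Measure.infinitePi_map_pi (X := fun _ : V => M × (M × M))
      (fun _ => p.prod (p.prod p)) (f := f) hf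
    simp only [hfp] at this
    rw [hμ, ← this, Measure.map_apply (by fun_prop) hS]
    rfl
  have hD : ∀ D : Set V, MeasurableSet
      (symmDiff (mixMarks univ ⁻¹' A) (mixMarks D ⁻¹' A) : Set (V → M × M)) := fun D =>
    (measurable_mixMarks _ hA).symmDiff (measurable_mixMarks _ hA)
  have m1 : Measurable fun m : V → M × M => fun x => (m x).1 := by fun_prop
  have m2 : Measurable fun m : V → M × M => fun x => (m x).2 := by fun_prop
  have e0 := hpush (fun _ y => (y.1, y.2.1)) (fun _ => by fun_prop) (fun _ => h12) _
    ((m1 hA).inter (m2 hA).compl)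
  have e1 : resampleDefect p A B = _ :=
    hpush (fun _ y => (y.1, y.2.1)) (fun _ => by fun_prop) (fun _ => h12) _ (hD B)
  -- Here the pair is `(W, Z)`; in `e1` it is `(X, Y)` and in `e3` it is `(Y, Z)`.
  have e2 : resampleDefect p A C = _ :=
    hpush (fun x y => if x ∈ B then (y.1, y.2.2) else (y.2.1, y.2.2))
      (fun x => by split_ifs <;> fun_prop) (fun x => by split_ifs <;> assumption) _ (hD C)
  have e3 : resampleDefect p A C = _ :=
    hpush (fun _ y => (y.2.1, y.2.2)) (fun _ => by fun_prop) (fun _ => h23) _ (hD C)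
  rw [hind, two_mul, e1]
  nth_rewrite 1 [e2]
  rw [e3]
  refine e0.trans_le ?_
  refine le_trans (measure_mono ?_) ((measure_union_le _ _).trans
    (add_le_add le_rfl (measure_union_le _ _)))
  rintro w ⟨h1, h2⟩
  have key : mixMarks C (fun x => if x ∈ B then ((w x).1, (w x).2.2)
      else ((w x).2.1, (w x).2.2)) = mixMarks C (fun x => ((w x).2.1, (w x).2.2)) := by
    funext x
    by_cases hx : x ∈ C
    · have : x ∉ B := fun h => hBC.le_bot ⟨h, hx⟩
      simp [mixMarks, hx, this]
    · by_cases hb : x ∈ B <;> simp [mixMarks, hx, hb]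
  have key' : mixMarks univ (fun x => if x ∈ B then ((w x).1, (w x).2.2)
      else ((w x).2.1, (w x).2.2)) = mixMarks B (fun x => ((w x).1, (w x).2.1)) := by
    funext x
    by_cases hb : x ∈ B <;> simp [mixMarks, hb]
  simp only [mem_union, mem_ofPred_eq, Set.mem_symmDiff, mem_preimage, key, key',
    mem_compl_iff] at h1 h2 ⊢
  simp only [mixMarks_univ]
  tauto

/-- A cylinder within `c / 2` of `A` depends on finitely many vertices, all in some `B n`, so
resampling off `B n` does not affect it. Both the original and the resampled configuration have the
law of i.i.d. marks, so each errs with probability below `c / 2`. -/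
theorem exists_resampleDefect_lt (p : Measure M) [IsProbabilityMeasure p] {A : Set (V → M)}
    (hA : MeasurableSet A) {B : ℕ → Set V} (hB : Monotone B) (hBU : ⋃ n, B n = univ)
    {c : ℝ≥0∞} (hc : c ≠ 0) : ∃ n, resampleDefect p A (B n) < c := by
  obtain ⟨t, ht, htA⟩ := exists_measure_symmDiff_lt_of_generateFrom_isSetRing
    (μ := Measure.infinitePi fun _ : V => p)
    (isSetAlgebra_measurableCylinders (α := fun _ : V => M)).isSetRing
    ⟨{univ}, countable_singleton _, by simpa using univ_mem_measurableCylinders fun _ : V => M, by simp⟩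
    (generateFrom_measurableCylinders (α := fun _ : V => M)).symm hA (ENNReal.half_pos hc)
  have htm := MeasurableSet.of_mem_measurableCylinders ht
  obtain ⟨s, S, -, rfl⟩ := (mem_measurableCylinders _).1 ht
  obtain ⟨n, hn⟩ : ∃ n, (s : Set V) ⊆ B n := by
    have : ∀ x ∈ s, ∃ n, x ∈ B n := fun x _ => mem_iUnion.1 (hBU ▸ mem_univ x)
    choose! f hf using this
    exact ⟨s.sup f, fun x hx => hB (Finset.le_sup hx) (hf x hx)⟩
  refine ⟨n, ?_⟩
  have hmix : ∀ D : Set V, Measure.infinitePi (fun _ : V => p.prod p)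
      (mixMarks D ⁻¹' (symmDiff (cylinder s S) A)) < c / 2 := by
    intro D
    rwa [← Measure.map_apply (measurable_mixMarks D) (htm.symmDiff hA), map_mixMarks]
  refine lt_of_le_of_lt (le_trans (measure_mono ?_) (measure_union_le _ _))
    ((ENNReal.add_lt_add (hmix univ) (hmix (B n))).trans_eq (ENNReal.add_halves c))
  intro m hm
  have key : mixMarks univ m ∈ cylinder s S ↔ mixMarks (B n) m ∈ cylinder s S := by
    have : s.restrict (mixMarks univ m) = s.restrict (mixMarks (B n) m) := by
      funext x
      simp [mixMarks, hn x.2]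
    rw [mem_cylinder, mem_cylinder, this]
  simp only [mem_union, Set.mem_symmDiff, mem_preimage] at hm ⊢
  tauto

end ProductMarks

/-! ### Balls and their isomorphisms. -/

namespace Network

variable {Ξ Θ M : Type*}

theorem skeleton_adj {G : Network Ξ Θ} {a b : G.V} :
    G.skeleton.Adj a b ↔ a ≠ b ∧ ∃ e, a ∈ G.ends e ∧ b ∈ G.ends e := by
  unfold skeleton
  rw [SimpleGraph.fromRel_adj]
  refine and_congr_right fun hab => ⟨?_, ?_⟩
  · rintro (⟨e, he⟩ | ⟨e, he⟩)
    · exact ⟨e, by simp [he], by simp [he]⟩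
    · exact ⟨e, by simp [he], by simp [he]⟩
  · rintro ⟨e, ha, hb⟩
    exact Or.inl ⟨e, (Sym2.mem_and_mem_iff hab).1 ⟨ha, hb⟩⟩

theorem skeleton_connected (G : Network Ξ Θ) : G.skeleton.Connected := G.connected

theorem mem_ball {G : Network Ξ Θ} {o v : G.V} {r : ℕ} :
    v ∈ G.ball o r ↔ G.skeleton.dist o v ≤ r := Iff.rfl

theorem ball_mono (G : Network Ξ Θ) (o : G.V) : Monotone (G.ball o) :=
  fun _ _ h _ hv => le_trans (mem_ball.1 hv) h

theorem iUnion_ball (G : Network Ξ Θ) (o : G.V) : ⋃ r, G.ball o r = univ :=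
  eq_univ_of_forall fun v => mem_iUnion.2 ⟨_, le_refl (G.skeleton.dist o v)⟩

theorem ball_subset_ball {G : Network Ξ Θ} {o u : G.V} {r R : ℕ}
    (h : G.skeleton.dist o u + r ≤ R) : G.ball u r ⊆ G.ball o R := fun v hv => by
  have := G.skeleton_connected.dist_triangle (u := o) (v := u) (w := v)
  have := mem_ball.1 hv
  exact mem_ball.2 (by omega)

theorem ballEdges_subset_ballEdges {G : Network Ξ Θ} {o u : G.V} {r R : ℕ}
    (h : G.skeleton.dist o u + r ≤ R) : G.ballEdges u r ⊆ G.ballEdges o R :=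
  fun _ he v hv => ball_subset_ball h (he v hv)

theorem finite_ballEdges (G : Network Ξ Θ) (o : G.V) (r : ℕ) : (G.ballEdges o r).Finite := by
  refine ((G.finite_ball o r).biUnion fun v _ => G.locallyFinite v).subset fun e he => ?_
  obtain ⟨v, hv⟩ : ∃ v, v ∈ G.ends e := ⟨_, Sym2.out_fst_mem _⟩
  exact mem_biUnion (he v hv) hv

instance (G : Network Ξ Θ) (o : G.V) (r : ℕ) : Finite (G.ball o r) := G.finite_ball o r

instance (G : Network Ξ Θ) (o : G.V) (r : ℕ) : Finite (G.ballEdges o r) := G.finite_ballEdges o r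

/-- Vertices at positive distance have a neighbour that is one step closer. -/
theorem exists_adj_dist_le {G : Network Ξ Θ} {u v : G.V} {k : ℕ}
    (h : G.skeleton.dist u v ≤ k + 1) :
    u = v ∨ ∃ w, G.skeleton.Adj u w ∧ G.skeleton.dist w v ≤ k := by
  obtain ⟨w, hw⟩ := G.skeleton_connected.exists_walk_length_eq_dist u v
  cases w with
  | nil => exact Or.inl rfl
  | @cons _ x _ hadj w =>
    refine Or.inr ⟨x, hadj, ?_⟩
    have : G.skeleton.dist x v ≤ w.length := SimpleGraph.dist_le w
    simp only [SimpleGraph.Walk.length_cons] at hw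
    omega

namespace BallIso

variable {G H K : Network Ξ Θ} {o : G.V} {p : H.V} {q : K.V} {r R : ℕ}

def symm (φ : BallIso G H o p r) : BallIso H G p o r where
  vMap := φ.vMap.symm
  eMap := φ.eMap.symm
  map_root := by rw [← φ.map_root]; simp
  mem_ends e v := by rw [φ.mem_ends]; simp

def comp (φ : BallIso G H o p r) (ψ : BallIso H K p q r) : BallIso G K o q r where
  vMap := φ.vMap.trans ψ.vMap
  eMap := φ.eMap.trans ψ.eMap
  map_root := by simp [φ.map_root, ψ.map_root]
  mem_ends e v := by rw [φ.mem_ends, ψ.mem_ends]; rfl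

theorem adj (φ : BallIso G H o p r) {u v : G.ball o r} (h : G.skeleton.Adj u v) :
    H.skeleton.Adj (φ.vMap u) (φ.vMap v) := by
  obtain ⟨hne, e, hu, hv⟩ := skeleton_adj.1 h
  have hee : G.ends e = s(↑u, ↑v) := (Sym2.mem_and_mem_iff hne).1 ⟨hu, hv⟩
  have he : e ∈ G.ballEdges o r := fun x hx => by
    rw [hee, Sym2.mem_iff] at hx
    rcases hx with rfl | rfl
    exacts [u.2, v.2]
  refine skeleton_adj.2 ⟨fun hc => hne ?_, φ.eMap ⟨e, he⟩, (φ.mem_ends ⟨e, he⟩ u).1 hu,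
    (φ.mem_ends ⟨e, he⟩ v).1 hv⟩
  exact congrArg Subtype.val (φ.vMap.injective (Subtype.ext hc))

/-- A geodesic of length at most `k` from `u` stays in the ball by `hu`, so `φ` carries it edge by
edge. Without `hu` the geodesic could leave the ball. -/
theorem dist_le (φ : BallIso G H o p R) {k : ℕ} {u v : G.ball o R}
    (hu : G.skeleton.dist o u + k ≤ R) (huv : G.skeleton.dist u.1 v ≤ k) :
    H.skeleton.dist (φ.vMap u).1 (φ.vMap v) ≤ k := by
  induction k generalizing u with
  | zero =>
    have := (G.skeleton_connected.dist_eq_zero_iff).1 (Nat.le_zero.1 huv)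
    rw [Subtype.ext this]
    simp
  | succ k ih =>
    rcases exists_adj_dist_le huv with h | ⟨w, hw, hwv⟩
    · rw [Subtype.ext h]
      simp
    · have h1 := G.skeleton_connected.dist_triangle (u := o) (v := u.1) (w := w)
      rw [SimpleGraph.dist_eq_one_iff_adj.2 hw] at h1
      have h2 := ih (u := ⟨w, mem_ball.2 (by omega)⟩) (by simp only; omega) hwv
      have h3 := H.skeleton_connected.dist_triangle (u := (φ.vMap u).1)
        (v := φ.vMap ⟨w, mem_ball.2 (by omega)⟩) (w := φ.vMap v)
      rw [SimpleGraph.dist_eq_one_iff_adj.2 (φ.adj (v := ⟨w, mem_ball.2 (by omega)⟩) hw)] at h3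
      omega

theorem dist_root (φ : BallIso G H o p R) (v : G.ball o R) :
    H.skeleton.dist p (φ.vMap v) = G.skeleton.dist o v := by
  have main : ∀ {G H : Network Ξ Θ} {o : G.V} {p : H.V} (φ : BallIso G H o p R)
      (v : G.ball o R), H.skeleton.dist p (φ.vMap v) ≤ G.skeleton.dist o v := by
    intro G H o p φ v
    have := φ.dist_le (k := G.skeleton.dist o v) (u := ⟨o, G.root_mem_ball o R⟩) (v := v)
      (by simpa using mem_ball.1 v.2) le_rfl
    rwa [φ.map_root] at this
  refine le_antisymm (main φ v) ?_
  simpa [symm] using main φ.symm (φ.vMap v)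

theorem mem_ball_iff (φ : BallIso G H o p R) {u : G.ball o R}
    (h : G.skeleton.dist o u + r ≤ R) (v : G.ball o R) :
    v.1 ∈ G.ball u.1 r ↔ (φ.vMap v).1 ∈ H.ball (φ.vMap u).1 r := by
  refine ⟨fun hv => φ.dist_le h hv, fun hv => ?_⟩
  have := φ.symm.dist_le (k := r) (u := φ.vMap u) (v := φ.vMap v) (by rwa [φ.dist_root]) hv
  simpa [symm, mem_ball] using this

theorem mem_ballEdges_iff (φ : BallIso G H o p R) {u : G.ball o R}
    (h : G.skeleton.dist o u + r ≤ R) (e : G.ballEdges o R) :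
    e.1 ∈ G.ballEdges u.1 r ↔ (φ.eMap e).1 ∈ H.ballEdges (φ.vMap u).1 r := by
  constructor
  · intro he v hv
    have h1 := (φ.mem_ends e (φ.vMap.symm ⟨v, (φ.eMap e).2 v hv⟩)).2 (by simpa)
    simpa using (φ.mem_ball_iff h _).1 (he _ h1)
  · intro he v hv
    have h1 := (φ.mem_ends e ⟨v, e.2 v hv⟩).1 hv
    exact (φ.mem_ball_iff h ⟨v, e.2 v hv⟩).2 (he _ h1)

/-- Restriction to a smaller ball about another vertex. -/
def recenter (φ : BallIso G H o p R) (u : G.ball o R) (h : G.skeleton.dist o u + r ≤ R) :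
    BallIso G H u.1 (φ.vMap u).1 r where
  vMap := (Equiv.subtypeSubtypeEquivSubtype fun hx => ball_subset_ball h hx).symm.trans
    ((φ.vMap.subtypeEquiv fun v => φ.mem_ball_iff h v).trans
      (Equiv.subtypeSubtypeEquivSubtype fun hx =>
        ball_subset_ball (by rwa [φ.dist_root]) hx))
  eMap := (Equiv.subtypeSubtypeEquivSubtype fun hx => ballEdges_subset_ballEdges h hx).symm.trans
    ((φ.eMap.subtypeEquiv fun e => φ.mem_ballEdges_iff h e).trans
      (Equiv.subtypeSubtypeEquivSubtype fun hx =>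
        ballEdges_subset_ballEdges (by rwa [φ.dist_root]) hx))
  map_root := rfl
  mem_ends e v := φ.mem_ends ⟨e, ballEdges_subset_ballEdges h e.2⟩ ⟨v, ball_subset_ball h v.2⟩

/-- Restriction to a smaller ball about the root. -/
def restrict (φ : BallIso G H o p R) (h : r ≤ R) : BallIso G H o p r where
  vMap := (φ.recenter (r := r) ⟨o, G.root_mem_ball o R⟩ (by simpa)).vMap.trans
    (Equiv.setCongr (by rw [φ.map_root]))
  eMap := (φ.recenter (r := r) ⟨o, G.root_mem_ball o R⟩ (by simpa)).eMap.trans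
    (Equiv.setCongr (by rw [φ.map_root]))
  map_root := by
    have h : (φ.vMap ⟨o, _⟩ : H.V) = p := congrArg Subtype.val φ.map_root
    exact Subtype.ext h
  mem_ends e v := φ.mem_ends ⟨e, ballEdges_subset_ballEdges (by simpa) e.2⟩
    ⟨v, ball_subset_ball (by simpa) v.2⟩

theorem restrict_vMap (φ : BallIso G H o p R) (h : r ≤ R) (v : G.ball o r) :
    ((φ.restrict h).vMap v).1 = (φ.vMap ⟨v, G.ball_mono o h v.2⟩).1 := rfl

variable [MetricSpace Ξ] [MetricSpace Θ] {ε δ : ℝ}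

theorem MarksWithin.mono {φ : BallIso G H o p r} (h : φ.MarksWithin ε) (hε : ε ≤ δ) :
    φ.MarksWithin δ :=
  ⟨fun v => (h.1 v).trans_le hε, fun e v hv => (h.2 e v hv).trans_le hε⟩

theorem MarksWithin.recenter {φ : BallIso G H o p R} (hφ : φ.MarksWithin ε) (u : G.ball o R)
    (h : G.skeleton.dist o u + r ≤ R) : (φ.recenter u h).MarksWithin ε :=
  ⟨fun v => hφ.1 ⟨v, ball_subset_ball h v.2⟩, fun e v hv =>
    hφ.2 ⟨e, ballEdges_subset_ballEdges h e.2⟩ ⟨v, ball_subset_ball h v.2⟩ hv⟩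

theorem MarksWithin.restrict {φ : BallIso G H o p R} (hφ : φ.MarksWithin ε) (h : r ≤ R) :
    (φ.restrict h).MarksWithin ε :=
  ⟨fun v => hφ.1 ⟨v, G.ball_mono o h v.2⟩, fun e v hv =>
    hφ.2 ⟨e, ballEdges_subset_ballEdges (by simpa) e.2⟩ ⟨v, G.ball_mono o h v.2⟩ hv⟩

theorem MarksWithin.comp {φ : BallIso G H o p r} {ψ : BallIso H K p q r} (hφ : φ.MarksWithin ε)
    (hψ : ψ.MarksWithin δ) : (φ.comp ψ).MarksWithin (ε + δ) :=
  ⟨fun v => (dist_triangle _ _ _).trans_lt (add_lt_add (hφ.1 v) (hψ.1 (φ.vMap v))),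
    fun e v hv => (dist_triangle _ _ _).trans_lt (add_lt_add (hφ.2 e v hv)
      (hψ.2 (φ.eMap e) (φ.vMap v) ((φ.mem_ends e v).1 hv)))⟩

/-- Finitely many strict inequalities leave a common slack. -/
theorem MarksWithin.exists_sub {φ : BallIso G H o p r} (hφ : φ.MarksWithin ε) :
    ∃ δ > 0, φ.MarksWithin (ε - δ) := by
  have key : ∀ d : ℝ, d < ε → ∀ᶠ δ in nhdsWithin (0 : ℝ) (Ioi 0), d < ε - δ := fun d hd =>
    nhdsWithin_le_nhds ((continuous_const.sub continuous_id).continuousAt.eventually_const_lt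
      (by simpa using hd))
  have h : ∀ᶠ δ in nhdsWithin (0 : ℝ) (Ioi 0), φ.MarksWithin (ε - δ) :=
    (Filter.eventually_all.2 fun v => key _ (hφ.1 v)).and
      (Filter.eventually_all.2 fun e => Filter.eventually_all.2 fun v =>
        Filter.eventually_all.2 fun hv => key _ (hφ.2 e v hv))
  obtain ⟨δ, hδ, h0⟩ := (h.and self_mem_nhdsWithin).exists
  exact ⟨δ, h0, hδ⟩

end BallIso

/-- The identity of a ball. -/
def BallIso.refl (G : Network Ξ Θ) (o : G.V) (r : ℕ) : BallIso G G o o r where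
  vMap := Equiv.refl _
  eMap := Equiv.refl _
  map_root := rfl
  mem_ends _ _ := Iff.rfl

theorem BallIso.refl_marksWithin [MetricSpace Ξ] [MetricSpace Θ] (G : Network Ξ Θ) (o : G.V)
    (r : ℕ) {ε : ℝ} (hε : 0 < ε) : (BallIso.refl G o r).MarksWithin ε :=
  ⟨fun _ => by simpa [refl] using hε, fun _ _ _ => by simpa [refl] using hε⟩

/-- An isomorphism of balls, for the networks with additional marks. -/
def BallIso.addMarks {G H : Network Ξ Θ} {o : G.V} {p : H.V} {r : ℕ} (φ : BallIso G H o p r)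
    (m : G.V → M) (m' : H.V → M) : BallIso (G.addMarks m) (H.addMarks m') o p r :=
  ⟨φ.vMap, φ.eMap, φ.map_root, φ.mem_ends⟩

theorem BallIso.MarksWithin.addMarks [MetricSpace Ξ] [MetricSpace Θ] [MetricSpace M]
    {G H : Network Ξ Θ} {o : G.V} {p : H.V} {r : ℕ} {φ : BallIso G H o p r} {ε : ℝ}
    (h : φ.MarksWithin ε) {m : G.V → M} {m' : H.V → M}
    (hm : ∀ v : G.ball o r, dist (m v) (m' (φ.vMap v)) < ε) :
    (φ.addMarks m m').MarksWithin ε :=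
  ⟨fun v => max_lt (h.1 v) (hm v), h.2⟩

end Network

/-! ### Local topology in terms of ball isomorphisms. -/

section Topology

open Network Filter

variable {Ξ Θ : Type*}

/-- The tolerance for marks that goes with balls of radius `n`. -/
noncomputable def tolerance (n : ℕ) : ℝ := 1 / ((n : ℝ) + 1)

theorem tolerance_pos (n : ℕ) : 0 < tolerance n := by unfold tolerance; positivity

theorem tolerance_antitone : Antitone tolerance := fun _ _ h => by
  unfold tolerance; gcongr

theorem eventually_tolerance_le {δ : ℝ} (hδ : 0 < δ) : ∀ᶠ n in atTop, tolerance n ≤ δ :=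
  (tendsto_one_div_add_atTop_nhds_zero_nat.eventually_lt_const hδ).mono fun _ h => h.le

@[elab_as_elim]
theorem GStar.ind {motive : GStar Ξ Θ → Prop} (h : ∀ G o, motive (GStar.mk G o))
    (x : GStar Ξ Θ) : motive x :=
  Quotient.ind (fun R => h R.toNetwork R.root) x

@[elab_as_elim]
theorem GStarStar.ind {motive : GStarStar Ξ Θ → Prop}
    (h : ∀ G o v, motive (GStarStar.mk G o v)) (x : GStarStar Ξ Θ) : motive x :=
  Quotient.ind (fun R => h R.toNetwork R.root R.root') x

theorem GStar.exists_iso {G H : Network Ξ Θ} {o : G.V} {p : H.V}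
    (h : GStar.mk G o = GStar.mk H p) : ∃ φ : Iso G H, φ.vMap o = p :=
  Quotient.exact h

theorem GStarStar.exists_iso {G H : Network Ξ Θ} {o v : G.V} {p w : H.V}
    (h : GStarStar.mk G o v = GStarStar.mk H p w) :
    ∃ φ : Iso G H, φ.vMap o = p ∧ φ.vMap v = w :=
  Quotient.exact h

variable [MetricSpace Ξ] [MetricSpace Θ]

theorem GStarStar.mk_mem_nhd {G H : Network Ξ Θ} {o v : G.V} {p w : H.V} {r : ℕ} {ε : ℝ} :
    GStarStar.mk H p w ∈ GStarStar.nhd G o v r ε ↔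
      ∃ φ : BallIso G H o p r, φ.MarksWithin ε ∧
        ∃ h : v ∈ G.ball o r, (φ.vMap ⟨v, h⟩ : H.V) = w := by
  constructor
  · rintro ⟨H', p', w', hy, φ, hφ, hv, rfl⟩
    obtain ⟨ψ, rfl, rfl⟩ := GStarStar.exists_iso hy.symm
    exact ⟨φ.trans ψ, hφ.trans ψ, hv, rfl⟩
  · exact fun h => ⟨H, p, w, rfl, h⟩

theorem GStar.isOpen_of_forall {U : Set (GStar Ξ Θ)}
    (h : ∀ (G : Network Ξ Θ) (o : G.V), GStar.mk G o ∈ U → ∃ n : ℕ, ∀ (H : Network Ξ Θ) (p : H.V)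
      (φ : BallIso G H o p n), φ.MarksWithin (tolerance n) → GStar.mk H p ∈ U) : IsOpen U := by
  refine isOpen_iff_forall_mem_open.2 fun x => GStar.ind (fun G o hx => ?_) x
  obtain ⟨n, hn⟩ := h G o hx
  refine ⟨GStar.nhd G o n (tolerance n), fun y => GStar.ind (fun H p hy => ?_) y,
    TopologicalSpace.isOpen_generateFrom_of_mem ⟨G, o, n, _, tolerance_pos n, rfl⟩,
    GStar.mk_mem_nhd.2 ⟨BallIso.refl G o n, BallIso.refl_marksWithin G o n (tolerance_pos n)⟩⟩
  obtain ⟨φ, hφ⟩ := GStar.mk_mem_nhd.1 hy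
  exact hn H p φ hφ

theorem GStarStar.isOpen_of_forall {U : Set (GStarStar Ξ Θ)}
    (h : ∀ (G : Network Ξ Θ) (o v : G.V), GStarStar.mk G o v ∈ U → ∃ (n : ℕ)
      (hv : v ∈ G.ball o n), ∀ (H : Network Ξ Θ) (p : H.V) (φ : BallIso G H o p n),
      φ.MarksWithin (tolerance n) → GStarStar.mk H p (φ.vMap ⟨v, hv⟩) ∈ U) : IsOpen U := by
  refine isOpen_iff_forall_mem_open.2 fun x => GStarStar.ind (fun G o v hx => ?_) x
  obtain ⟨n, hv, hn⟩ := h G o v hx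
  refine ⟨GStarStar.nhd G o v n (tolerance n), fun y => GStarStar.ind (fun H p w hy => ?_) y,
    TopologicalSpace.isOpen_generateFrom_of_mem ⟨G, o, v, n, _, tolerance_pos n, rfl⟩,
    GStarStar.mk_mem_nhd.2 ⟨BallIso.refl G o n,
      BallIso.refl_marksWithin G o n (tolerance_pos n), hv, rfl⟩⟩
  obtain ⟨φ, hφ, -, rfl⟩ := GStarStar.mk_mem_nhd.1 hy
  exact hn H p φ hφ

/-- Composition with an isomorphism of much larger balls with much closer marks stays within a
basic neighbourhood. -/
theorem Network.BallIso.MarksWithin.eventually_comp {G H : Network Ξ Θ} {o : G.V} {p : H.V}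
    {r : ℕ} {ε : ℝ} {φ : BallIso G H o p r} (hφ : φ.MarksWithin ε) :
    ∀ᶠ n in atTop, ∃ hn : r ≤ n, ∀ (K : Network Ξ Θ) (q : K.V) (ψ : BallIso H K p q n),
      ψ.MarksWithin (tolerance n) → (φ.comp (ψ.restrict hn)).MarksWithin ε := by
  obtain ⟨δ, hδ, hφ'⟩ := hφ.exists_sub
  filter_upwards [eventually_ge_atTop r, eventually_tolerance_le hδ] with n hn hnδ
  exact ⟨hn, fun K q ψ hψ => (hφ'.comp (hψ.restrict hn)).mono (by linarith)⟩

/-- The form with all large `n`, rather than one `n`, allows finite intersections here and finitely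
many vertices at once later. -/
theorem GStarStar.eventually_of_isOpen {U : Set (GStarStar Ξ Θ)} (hU : IsOpen U)
    {G : Network Ξ Θ} {o v : G.V} (hx : GStarStar.mk G o v ∈ U) : ∀ᶠ n in atTop,
      ∀ (H : Network Ξ Θ) (p : H.V) (φ : BallIso G H o p n), φ.MarksWithin (tolerance n) →
        ∀ hv : v ∈ G.ball o n, GStarStar.mk H p (φ.vMap ⟨v, hv⟩) ∈ U := by
  induction hU with
  | basic U hU =>
    obtain ⟨G₀, o₀, v₀, r, ε, hε, rfl⟩ := hU
    obtain ⟨φ₀, hφ₀, hv₀, rfl⟩ := GStarStar.mk_mem_nhd.1 hx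
    filter_upwards [hφ₀.eventually_comp] with n ⟨hn, h⟩ H p φ hφ hv
    exact GStarStar.mk_mem_nhd.2 ⟨_, h H p φ hφ, hv₀, rfl⟩
  | univ => exact Eventually.of_forall fun _ _ _ _ _ _ => mem_univ _
  | inter U V _ _ ihU ihV =>
    filter_upwards [ihU hx.1, ihV hx.2] with n h1 h2 H p φ hφ hv
    exact ⟨h1 H p φ hφ hv, h2 H p φ hφ hv⟩
  | sUnion S _ ih =>
    obtain ⟨U, hU, hxU⟩ := hx
    filter_upwards [ih U hU hxU] with n h H p φ hφ hv
    exact ⟨U, hU, h H p φ hφ hv⟩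

/-- The class `[G, o, o]`. -/
def GStar.diag : GStar Ξ Θ → GStarStar Ξ Θ :=
  Quotient.lift (fun R : RootedNetwork Ξ Θ => GStarStar.mk R.toNetwork R.root R.root) (by
    rintro R S ⟨φ, h⟩
    rw [← h]
    exact GStarStar.mk_eq φ _ _)

/-- The class `[G, o]` for `[G, o, v]`. -/
def GStarStar.fst : GStarStar Ξ Θ → GStar Ξ Θ :=
  Quotient.lift (fun R : DoublyRootedNetwork Ξ Θ => GStar.mk R.toNetwork R.root) (by
    rintro R S ⟨φ, h, -⟩
    rw [← h]
    exact GStar.mk_eq φ _)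

/-- The class `[G, v, o]` for `[G, o, v]`. -/
def GStarStar.swap : GStarStar Ξ Θ → GStarStar Ξ Θ :=
  Quotient.lift (fun R : DoublyRootedNetwork Ξ Θ => GStarStar.mk R.toNetwork R.root' R.root) (by
    rintro R S ⟨φ, h, h'⟩
    rw [← h, ← h']
    exact GStarStar.mk_eq φ _ _)

omit [MetricSpace Ξ] [MetricSpace Θ] in
@[simp] theorem GStar.diag_mk (G : Network Ξ Θ) (o : G.V) :
    (GStar.mk G o).diag = GStarStar.mk G o o := rfl

omit [MetricSpace Ξ] [MetricSpace Θ] in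
@[simp] theorem GStarStar.fst_mk (G : Network Ξ Θ) (o v : G.V) :
    (GStarStar.mk G o v).fst = GStar.mk G o := rfl

omit [MetricSpace Ξ] [MetricSpace Θ] in
@[simp] theorem GStarStar.swap_mk (G : Network Ξ Θ) (o v : G.V) :
    (GStarStar.mk G o v).swap = GStarStar.mk G v o := rfl

theorem GStar.continuous_diag : Continuous (GStar.diag (Ξ := Ξ) (Θ := Θ)) := by
  refine ⟨fun U hU => GStar.isOpen_of_forall fun G o hx => ?_⟩
  obtain ⟨n, hn⟩ := (GStarStar.eventually_of_isOpen hU (G := G) (o := o) (v := o) hx).exists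
  refine ⟨n, fun H p φ hφ => ?_⟩
  have := hn H p φ hφ (G.root_mem_ball o n)
  rwa [φ.map_root] at this

theorem GStarStar.continuous_fst : Continuous (GStarStar.fst (Ξ := Ξ) (Θ := Θ)) := by
  refine continuous_generateFrom_iff.2 ?_
  rintro _ ⟨G₀, o₀, r, ε, hε, rfl⟩
  refine GStarStar.isOpen_of_forall fun G o v hx => ?_
  obtain ⟨φ₀, hφ₀⟩ := GStar.mk_mem_nhd.1 hx
  obtain ⟨n, ⟨hn, h⟩, hv⟩ := (hφ₀.eventually_comp.and
    (eventually_ge_atTop (G.skeleton.dist o v))).exists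
  exact ⟨n, hv, fun H p φ hφ => GStar.mk_mem_nhd.2 ⟨_, h H p φ hφ⟩⟩

theorem GStarStar.continuous_swap : Continuous (GStarStar.swap (Ξ := Ξ) (Θ := Θ)) := by
  refine ⟨fun U hU => GStarStar.isOpen_of_forall fun G o v hx => ?_⟩
  obtain ⟨r, hr, hv⟩ := ((GStarStar.eventually_of_isOpen hU (G := G) (o := v) (v := o) hx).and
    (eventually_ge_atTop (G.skeleton.dist v o))).exists
  -- With this radius the ball about `o` contains the `r`-ball about `v`, and `φ` can be recentred
  -- there.
  refine ⟨G.skeleton.dist o v + r, Nat.le_add_right _ _, fun H p φ hφ => ?_⟩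
  have := hr H _ (φ.recenter ⟨v, Nat.le_add_right _ _⟩ le_rfl)
    ((hφ.recenter _ le_rfl).mono (tolerance_antitone (Nat.le_add_left _ _))) hv
  have h2 : ((φ.recenter ⟨v, Nat.le_add_right _ _⟩ le_rfl).vMap ⟨o, hv⟩ : H.V) = p :=
    congrArg Subtype.val φ.map_root
  rwa [h2] at this

end Topology

/-! ### Counting measure of a second root, and mass transport as symmetry. -/

section RootMeasure

open Network Filter

variable {Ξ Θ : Type*} [MetricSpace Ξ] [MetricSpace Θ]

/-- The counting measure on the classes `[G, o, v]` with `v` in the ball of radius `r`. -/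
noncomputable def GStar.ballMeasure (r : ℕ) : GStar Ξ Θ → Measure (GStarStar Ξ Θ) :=
  Quotient.lift (fun R : RootedNetwork Ξ Θ => Measure.sum fun v : R.ball R.root r =>
      Measure.dirac (GStarStar.mk R.toNetwork R.root v)) (by
    rintro R S ⟨φ, h⟩
    ext A hA
    rw [Measure.sum_apply _ hA, Measure.sum_apply _ hA, ← h,
      ← (φ.vMap.subtypeEquiv (φ.mem_ball R.root r)).tsum_eq]
    exact tsum_congr fun v => by rw [GStarStar.mk_eq φ]; rfl)

/-- The counting measure on the classes `[G, o, v]`. -/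
noncomputable def GStar.rootMeasure : GStar Ξ Θ → Measure (GStarStar Ξ Θ) :=
  Quotient.lift (fun R : RootedNetwork Ξ Θ => Measure.sum fun v : R.V =>
      Measure.dirac (GStarStar.mk R.toNetwork R.root v)) (by
    rintro R S ⟨φ, h⟩
    ext A hA
    rw [Measure.sum_apply _ hA, Measure.sum_apply _ hA, ← h, ← φ.vMap.tsum_eq]
    exact tsum_congr fun v => by rw [GStarStar.mk_eq φ])

theorem GStar.lintegral_ballMeasure {r : ℕ} {G : Network Ξ Θ} {o : G.V}
    {g : GStarStar Ξ Θ → ℝ≥0∞} (hg : Measurable g) :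
    ∫⁻ y, g y ∂(GStar.mk G o).ballMeasure r = ∑' v : G.ball o r, g (GStarStar.mk G o v) :=
  (lintegral_sum_measure _ _).trans (tsum_congr fun _ => lintegral_dirac' _ hg)

theorem GStar.lintegral_rootMeasure {G : Network Ξ Θ} {o : G.V}
    {g : GStarStar Ξ Θ → ℝ≥0∞} (hg : Measurable g) :
    ∫⁻ y, g y ∂(GStar.mk G o).rootMeasure = ∑' v, g (GStarStar.mk G o v) :=
  (lintegral_sum_measure _ _).trans (tsum_congr fun _ => lintegral_dirac' _ hg)

instance GStar.isFiniteMeasure_ballMeasure (r : ℕ) (x : GStar Ξ Θ) :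
    IsFiniteMeasure (x.ballMeasure r) := by
  induction x using GStar.ind with
  | h G o =>
    refine ⟨?_⟩
    rw [← lintegral_one, GStar.lintegral_ballMeasure measurable_const]
    have := Fintype.ofFinite (G.ball o r)
    rw [tsum_fintype]
    simp

/-- For open `U`, the number of `v` in the ball with `[G, o, v] ∈ U` is lower semicontinuous: the
ball is finite, so all these memberships persist in networks close to `G`. The passage from open to
Borel sets uses finite measures, which is why balls come before `rootMeasure`. -/
theorem GStar.measurable_ballMeasure (r : ℕ) :
    Measurable (GStar.ballMeasure (Ξ := Ξ) (Θ := Θ) r) := by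
  have hopen : ∀ U : Set (GStarStar Ξ Θ), IsOpen U →
      Measurable fun x : GStar Ξ Θ => x.ballMeasure r U := by
    intro U hU
    refine measurable_of_Ioi fun c => (GStar.isOpen_of_forall fun G o hc => ?_).measurableSet
    have hformula : ∀ (H : Network Ξ Θ) (p : H.V), (GStar.mk H p).ballMeasure r U =
        ∑' v : H.ball p r, U.indicator 1 (GStarStar.mk H p v) := fun H p => by
      rw [← lintegral_indicator_one hU.measurableSet,
        GStar.lintegral_ballMeasure (measurable_one.indicator hU.measurableSet)]
    have hev : ∀ᶠ n in atTop, ∀ v : G.ball o r, GStarStar.mk G o v ∈ U →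
        ∀ (H : Network Ξ Θ) (p : H.V) (φ : BallIso G H o p n), φ.MarksWithin (tolerance n) →
        ∀ hv : v.1 ∈ G.ball o n, GStarStar.mk H p (φ.vMap ⟨v, hv⟩) ∈ U := by
      refine eventually_all.2 fun v => ?_
      by_cases hv : GStarStar.mk G o v.1 ∈ U
      · exact (GStarStar.eventually_of_isOpen hU hv).mono fun n hn _ => hn
      · exact Eventually.of_forall fun n h => absurd h hv
    obtain ⟨n, hn, hrn⟩ := (hev.and (eventually_ge_atTop r)).exists
    refine ⟨n, fun H p φ hφ => ?_⟩
    rw [mem_preimage, mem_Ioi, hformula] at hc ⊢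
    refine hc.trans_le ?_
    rw [← (φ.restrict hrn).vMap.tsum_eq]
    refine ENNReal.tsum_le_tsum fun v => ?_
    by_cases hv : GStarStar.mk G o v.1 ∈ U
    · have := hn v hv H p φ hφ (G.ball_mono o hrn v.2)
      rw [φ.restrict_vMap, indicator_of_mem this, indicator_of_mem hv]
      rfl
    · simp [hv]
  exact Measurable.measure_of_isPiSystem (BorelSpace.measurable_eq.trans rfl) isPiSystem_isOpen hopen
    (hopen _ isOpen_univ)

theorem GStar.rootMeasure_eq_iSup (x : GStar Ξ Θ) {A : Set (GStarStar Ξ Θ)}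
    (hA : MeasurableSet A) : x.rootMeasure A = ⨆ r, x.ballMeasure r A := by
  induction x using GStar.ind with
  | h G o =>
    have hm : Measurable (A.indicator (1 : GStarStar Ξ Θ → ℝ≥0∞)) := measurable_one.indicator hA
    simp only [← lintegral_indicator_one hA, GStar.lintegral_rootMeasure hm,
      GStar.lintegral_ballMeasure hm]
    refine le_antisymm ?_ (iSup_le fun r =>
      ENNReal.tsum_comp_le_tsum_of_injective Subtype.val_injective _)
    rw [ENNReal.tsum_eq_iSup_sum]
    refine iSup_le fun s => le_iSup_of_le (s.sup (G.skeleton.dist o)) ?_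
    rw [← Finset.tsum_subtype]
    exact ENNReal.tsum_mono_subtype (fun v => A.indicator 1 (GStarStar.mk G o v))
      fun v hv => mem_ball.2 (Finset.le_sup hv)

theorem GStar.measurable_rootMeasure : Measurable (GStar.rootMeasure (Ξ := Ξ) (Θ := Θ)) := by
  refine Measure.measurable_of_measurable_coe _ fun A hA => ?_
  simp only [GStar.rootMeasure_eq_iSup _ hA]
  exact .iSup fun r => (Measure.measurable_coe hA).comp (GStar.measurable_ballMeasure r)

theorem massOut_eq_lintegral {g : GStarStar Ξ Θ → ℝ≥0} (hg : Measurable g) (x : GStar Ξ Θ) :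
    massOut g x = ∫⁻ y, g y ∂x.rootMeasure := by
  induction x using GStar.ind with
  | h G o => exact (GStar.lintegral_rootMeasure hg.coe_nnreal_ennreal).symm

theorem massIn_eq_lintegral {g : GStarStar Ξ Θ → ℝ≥0} (hg : Measurable g) (x : GStar Ξ Θ) :
    massIn g x = ∫⁻ y, g y.swap ∂x.rootMeasure := by
  induction x using GStar.ind with
  | h G o =>
    exact (GStar.lintegral_rootMeasure (g := fun y => (g y.swap : ℝ≥0∞))
      (hg.coe_nnreal_ennreal.comp GStarStar.continuous_swap.measurable)).symm

/-- The mass transport principle says that the law of a root together with the counting measure of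
a second root is symmetric. -/
theorem isUnimodular_iff {μ : Measure (GStar Ξ Θ)} : IsUnimodular μ ↔
    IsProbabilityMeasure μ ∧
      (μ.bind GStar.rootMeasure).map GStarStar.swap = μ.bind GStar.rootMeasure := by
  have hs := GStarStar.continuous_swap (Ξ := Ξ) (Θ := Θ) |>.measurable
  have hr := GStar.measurable_rootMeasure (Ξ := Ξ) (Θ := Θ)
  have hout : ∀ g : GStarStar Ξ Θ → ℝ≥0, Measurable g →
      ∫⁻ x, massOut g x ∂μ = ∫⁻ y, g y ∂μ.bind GStar.rootMeasure := fun g hg => by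
    rw [Measure.lintegral_bind hr.aemeasurable hg.coe_nnreal_ennreal.aemeasurable]
    exact lintegral_congr fun x => massOut_eq_lintegral hg x
  have hin : ∀ g : GStarStar Ξ Θ → ℝ≥0, Measurable g →
      ∫⁻ x, massIn g x ∂μ = ∫⁻ y, g y ∂(μ.bind GStar.rootMeasure).map GStarStar.swap :=
    fun g hg => by
    rw [lintegral_map hg.coe_nnreal_ennreal hs, Measure.lintegral_bind hr.aemeasurable
      (f := fun y : GStarStar Ξ Θ => (g y.swap : ℝ≥0∞)) (hg.coe_nnreal_ennreal.comp hs).aemeasurable]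
    exact lintegral_congr fun x => massIn_eq_lintegral hg x
  refine and_congr_right fun _ => ⟨fun h => ?_, fun h g hg => by rw [hout g hg, hin g hg, h]⟩
  ext A hA
  have hm : Measurable (A.indicator (1 : GStarStar Ξ Θ → ℝ≥0)) := measurable_one.indicator hA
  have := h _ hm
  rw [hout _ hm, hin _ hm] at this
  simpa [ENNReal.coe_indicator, lintegral_indicator hA] using this.symm

end RootMeasure

/-! ### Changing marks according to the distance from the root. -/

section Relabel

open Network Filter

variable {Ξ Ξ' Θ : Type*}

/-- Change the vertex marks, depending on the distance to `o`. -/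
noncomputable def Network.relabel (f : ℕ → Ξ → Ξ') (G : Network Ξ Θ) (o : G.V) : Network Ξ' Θ where
  V := G.V
  E := G.E
  ends := G.ends
  vmark v := f (G.skeleton.dist o v) (G.vmark v)
  emark := G.emark
  connected := G.connected
  locallyFinite := G.locallyFinite

/-- Change the vertex marks, depending on the distance to the root. -/
noncomputable def GStar.relabel (f : ℕ → Ξ → Ξ') : GStar Ξ Θ → GStar Ξ' Θ :=
  Quotient.lift (fun R : RootedNetwork Ξ Θ => GStar.mk (R.toNetwork.relabel f R.root) R.root) (by
    rintro R S ⟨φ, h⟩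
    have hv : ∀ v : R.V, f (S.skeleton.dist S.root (φ.vMap v)) (S.vmark (φ.vMap v)) =
        f (R.skeleton.dist R.root v) (R.vmark v) := fun v => by
      rw [φ.vmark_eq, ← h, φ.dist_eq]
    exact Quotient.sound ⟨⟨φ.vMap, φ.eMap, φ.mem_ends, hv, φ.emark_eq⟩, h⟩)

theorem GStar.relabel_mk (f : ℕ → Ξ → Ξ') (G : Network Ξ Θ) (o : G.V) :
    (GStar.mk G o).relabel f = GStar.mk (G.relabel f o) o := rfl

theorem GStar.continuous_relabel [MetricSpace Ξ] [MetricSpace Ξ'] [MetricSpace Θ]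
    {f : ℕ → Ξ → Ξ'} (hf : ∀ k a b, dist (f k a) (f k b) ≤ dist a b) :
    Continuous (GStar.relabel (Θ := Θ) f) := by
  refine continuous_generateFrom_iff.2 ?_
  rintro _ ⟨G₀, o₀, r, ε, hε, rfl⟩
  refine GStar.isOpen_of_forall fun G o hx => ?_
  rw [mem_preimage, GStar.relabel_mk] at hx
  obtain ⟨φ₀, hφ₀⟩ := GStar.mk_mem_nhd.1 hx
  obtain ⟨n, hn, h⟩ := hφ₀.eventually_comp.exists
  refine ⟨n, fun H p φ hφ => ?_⟩
  have hv : ∀ v : G.ball o n, dist (f (G.skeleton.dist o v) (G.vmark v))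
      (f (H.skeleton.dist p (φ.vMap v)) (H.vmark (φ.vMap v))) < tolerance n := fun v => by
    rw [φ.dist_root]
    exact (hf _ _ _).trans_lt (hφ.1 v)
  rw [mem_preimage, GStar.relabel_mk]
  exact GStar.mk_mem_nhd.2 ⟨_, h (H.relabel f p) p
    ⟨φ.vMap, φ.eMap, φ.map_root, φ.mem_ends⟩ ⟨hv, hφ.2⟩⟩

end Relabel

/-! ### The i.i.d. marking kernel: measurability and unimodularity. -/

section MarkLaw

open Network Filter

variable {Ξ Θ M : Type*} [MetricSpace Ξ] [MetricSpace Θ] [MetricSpace M]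
  [TopologicalSpace.SeparableSpace M] [MeasurableSpace M] [BorelSpace M]

theorem measurable_mk_addMarks₂ (G : Network Ξ Θ) (o v : G.V) :
    Measurable (fun m : G.V → M => GStarStar.mk (G.addMarks m) o v) := by
  have : Countable G.V := G.countable_V
  have : SecondCountableTopology M := UniformSpace.secondCountable_of_separable M
  refine Continuous.measurable ⟨fun U hU => isOpen_iff_mem_nhds.2 fun m hm => ?_⟩
  obtain ⟨n, hn, hv⟩ := ((GStarStar.eventually_of_isOpen hU hm).and
    (eventually_ge_atTop (G.skeleton.dist o v))).exists
  have hev : ∀ᶠ m' : G.V → M in nhds m, ∀ x : G.ball o n, dist (m x) (m' x) < tolerance n := by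
    refine eventually_all.2 fun x => ?_
    have hc : Continuous fun m' : G.V → M => dist (m x) (m' x) := by fun_prop
    exact hc.continuousAt.eventually_lt continuousAt_const (by simpa using tolerance_pos n)
  filter_upwards [hev] with m' hm'
  exact hn (G.addMarks m') o ((BallIso.refl G o n).addMarks m m')
    ((BallIso.refl_marksWithin G o n (tolerance_pos n)).addMarks hm') hv

/-- The law of the class of `(G, o, v)` after adding independent marks with common law `p`. -/
noncomputable def markLaw₂ (p : Measure M) [IsProbabilityMeasure p] :
    GStarStar Ξ Θ → Measure (GStarStar (Ξ × M) Θ) :=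
  Quotient.lift (fun R : DoublyRootedNetwork Ξ Θ =>
      (Measure.infinitePi fun _ : R.V => p).map
        fun m => GStarStar.mk (R.toNetwork.addMarks m) R.root R.root') (by
    rintro R S ⟨φ, h, h'⟩
    have hinj : (Measure.infinitePi fun _ : S.V => p).map (fun m v => m (φ.vMap v)) =
        Measure.infinitePi fun _ : R.V => p :=
      Measure.map_infinitePi_infinitePi_of_inj (P := fun _ : S.V => p) φ.vMap.injective
    rw [← hinj, Measure.map_map (measurable_mk_addMarks₂ _ _ _) (by fun_prop), ← h, ← h']
    exact congrArg (fun F => Measure.map F _)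
      (funext fun m => GStarStar.mk_eq (φ.addMarks m) R.root R.root'))

theorem markLaw₂_apply (p : Measure M) [IsProbabilityMeasure p] (G : Network Ξ Θ) (o v : G.V)
    {A : Set (GStarStar (Ξ × M) Θ)} (hA : MeasurableSet A) :
    markLaw₂ p (GStarStar.mk G o v) A =
      Measure.infinitePi (fun _ : G.V => p) {m | GStarStar.mk (G.addMarks m) o v ∈ A} :=
  Measure.map_apply (measurable_mk_addMarks₂ G o v) hA

theorem markLaw_apply (p : Measure M) [IsProbabilityMeasure p] (G : Network Ξ Θ) (o : G.V)
    {A : Set (GStar (Ξ × M) Θ)} (hA : MeasurableSet A) :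
    markLaw p (GStar.mk G o) A =
      Measure.infinitePi (fun _ : G.V => p) {m | GStar.mk (G.addMarks m) o ∈ A} :=
  Measure.map_apply (measurable_mk_addMarks G o) hA

instance isProbabilityMeasure_markLaw₂ (p : Measure M) [IsProbabilityMeasure p]
    (x : GStarStar Ξ Θ) : IsProbabilityMeasure (markLaw₂ p x) := by
  induction x using GStarStar.ind with
  | h G o v =>
    exact Measure.isProbabilityMeasure_map (measurable_mk_addMarks₂ G o v).aemeasurable

instance isProbabilityMeasure_markLaw (p : Measure M) [IsProbabilityMeasure p]
    (x : GStar Ξ Θ) : IsProbabilityMeasure (markLaw p x) := by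
  induction x using GStar.ind with
  | h G o => exact Measure.isProbabilityMeasure_map (measurable_mk_addMarks G o).aemeasurable

/-- Membership in `U` is certified by a finite ball with some tolerance, and up to small probability
one radius `n` serves for all mark configurations. The marks on isomorphic `n`-balls have the same
law, so the bound carries over to networks close to `G`. -/
theorem isOpen_lt_markLaw₂ (p : Measure M) [IsProbabilityMeasure p]
    {U : Set (GStarStar (Ξ × M) Θ)} (hU : IsOpen U) (c : ℝ≥0∞) :
    IsOpen {x : GStarStar Ξ Θ | c < markLaw₂ p x U} := by
  refine GStarStar.isOpen_of_forall fun G o v hc => ?_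
  rw [mem_ofPred_eq, markLaw₂_apply p G o v hU.measurableSet] at hc
  set W : ℕ → Set (G.V → M) := fun n => {m | ∃ hv : v ∈ G.ball o n,
    ∀ (H : Network (Ξ × M) Θ) (q : H.V) (φ : BallIso (G.addMarks m) H o q n),
      φ.MarksWithin (tolerance n) → GStarStar.mk H q (φ.vMap ⟨v, hv⟩) ∈ U}
  have hsub : {m | GStarStar.mk (G.addMarks m) o v ∈ U} ⊆
      ⋃ k, ⋂ n ≥ k, W n := fun m hm => by
    obtain ⟨k, hk⟩ := eventually_atTop.1 ((GStarStar.eventually_of_isOpen hU hm).and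
      (eventually_ge_atTop (G.skeleton.dist o v)))
    exact mem_iUnion.2 ⟨k, mem_iInter₂.2 fun n hn =>
      ⟨(hk n hn).2, fun H q φ hφ => (hk n hn).1 H q φ hφ (hk n hn).2⟩⟩
  -- Tail intersections increase by construction, and continuity from below along them needs no
  -- measurability of `W n`.
  have hmono : Monotone fun k => ⋂ n ≥ k, W n := fun k l hkl =>
    biInter_subset_biInter_left fun n hn => le_trans hkl hn
  have hlt := hc.trans_le (measure_mono hsub)
  rw [hmono.measure_iUnion, lt_iSup_iff] at hlt
  obtain ⟨n, hn⟩ := hlt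
  replace hn := hn.trans_le (measure_mono (biInter_subset_of_mem (le_refl n)))
  obtain ⟨m₀, hv, -⟩ : (W n).Nonempty := nonempty_of_measure_ne_zero (pos_of_gt hn).ne'
  refine ⟨n, hv, fun H q φ hφ => ?_⟩
  rw [mem_ofPred_eq, markLaw₂_apply p H q _ hU.measurableSet]
  have : SecondCountableTopology M := UniformSpace.secondCountable_of_separable M
  -- The open hull `Z` replaces `W n`, which is not known to be measurable: it involves only the
  -- marks in the ball, hence can be read off in `G` and in `H` alike.
  set Z : Set (G.ball o n → M) :=
    ⋃ m ∈ W n, {z | ∀ x : G.ball o n, dist (m x) (z x) < tolerance n} with hZ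
  have hZo : IsOpen Z := isOpen_biUnion fun m _ => by
    rw [ofPred_forall]
    exact isOpen_iInter_of_finite fun x =>
      isOpen_lt (by fun_prop) continuous_const
  have hG : Measure.infinitePi (fun _ : G.V => p) {m | (fun x : G.ball o n => m x) ∈ Z} =
      Measure.infinitePi (fun _ : G.ball o n => p) Z := by
    rw [← Measure.map_infinitePi_infinitePi_of_inj (P := fun _ : G.V => p)
      (f := fun x : G.ball o n => x.1) Subtype.val_injective,
      Measure.map_apply (by fun_prop) hZo.measurableSet]
    rfl
  have hH : Measure.infinitePi (fun _ : H.V => p)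
      {m | (fun x : G.ball o n => m (φ.vMap x)) ∈ Z} =
      Measure.infinitePi (fun _ : G.ball o n => p) Z := by
    rw [← Measure.map_infinitePi_infinitePi_of_inj (P := fun _ : H.V => p)
      (f := fun x : G.ball o n => (φ.vMap x).1)
      (Subtype.val_injective.comp φ.vMap.injective),
      Measure.map_apply (by fun_prop) hZo.measurableSet]
    rfl
  have h1 : W n ⊆ {m | (fun x : G.ball o n => m x) ∈ Z} := fun m hm =>
    mem_iUnion₂.2 ⟨m, hm, fun x => by simpa using tolerance_pos n⟩
  have h2 : {m | (fun x : G.ball o n => m (φ.vMap x)) ∈ Z} ⊆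
      {m' : H.V → M | GStarStar.mk (H.addMarks m') q (φ.vMap ⟨v, hv⟩).1 ∈ U} := fun m' hm' => by
    obtain ⟨m, ⟨_, hm⟩, hmm'⟩ := mem_iUnion₂.1 hm'
    exact hm (H.addMarks m') q (φ.addMarks m m') (hφ.addMarks hmm')
  exact hn.trans_le ((measure_mono h1).trans ((hG.trans hH.symm).le.trans (measure_mono h2)))

theorem measurable_markLaw₂ (p : Measure M) [IsProbabilityMeasure p] :
    Measurable (markLaw₂ (Ξ := Ξ) (Θ := Θ) p) :=
  Measurable.measure_of_isPiSystem_of_isProbabilityMeasure (BorelSpace.measurable_eq.trans rfl)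
    isPiSystem_isOpen fun _ hU => measurable_of_Ioi fun c =>
      (isOpen_lt_markLaw₂ p hU c).measurableSet

theorem markLaw_eq_map (p : Measure M) [IsProbabilityMeasure p] (x : GStar Ξ Θ) :
    markLaw p x = (markLaw₂ p x.diag).map GStarStar.fst := by
  induction x using GStar.ind with
  | h G o =>
    exact (Measure.map_map GStarStar.continuous_fst.measurable
      (measurable_mk_addMarks₂ G o o)).symm

theorem measurable_markLaw (p : Measure M) [IsProbabilityMeasure p] :
    Measurable (markLaw (Ξ := Ξ) (Θ := Θ) p) := by
  rw [funext (markLaw_eq_map p)]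
  exact (Measure.measurable_map _ GStarStar.continuous_fst.measurable).comp
    ((measurable_markLaw₂ p).comp GStar.continuous_diag.measurable)

theorem markLaw₂_swap (p : Measure M) [IsProbabilityMeasure p] (x : GStarStar Ξ Θ) :
    markLaw₂ p x.swap = (markLaw₂ p x).map GStarStar.swap := by
  induction x using GStarStar.ind with
  | h G o v =>
    exact (Measure.map_map GStarStar.continuous_swap.measurable
      (measurable_mk_addMarks₂ G o v)).symm

/-- The vertex set does not depend on the marks, so the sum over second roots can be exchanged with
the integral over marks. -/
theorem markLaw_bind_rootMeasure (p : Measure M) [IsProbabilityMeasure p] (x : GStar Ξ Θ) :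
    (markLaw p x).bind GStar.rootMeasure = x.rootMeasure.bind (markLaw₂ p) := by
  induction x using GStar.ind with
  | h G o =>
    have : Countable G.V := G.countable_V
    ext A hA
    have hm : Measurable (A.indicator (1 : GStarStar (Ξ × M) Θ → ℝ≥0∞)) :=
      measurable_one.indicator hA
    rw [Measure.bind_apply hA GStar.measurable_rootMeasure.aemeasurable,
      Measure.bind_apply hA (measurable_markLaw₂ p).aemeasurable,
      GStar.lintegral_rootMeasure (g := fun y => markLaw₂ p y A)
        ((Measure.measurable_coe hA).comp (measurable_markLaw₂ p))]
    have h1 : ∫⁻ y, y.rootMeasure A ∂markLaw p (GStar.mk G o) =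
        ∫⁻ m, (GStar.mk (G.addMarks m) o).rootMeasure A
          ∂Measure.infinitePi fun _ : G.V => p :=
      lintegral_map ((Measure.measurable_coe hA).comp GStar.measurable_rootMeasure)
        (measurable_mk_addMarks G o)
    have h2 : ∀ m : G.V → M, (GStar.mk (G.addMarks m) o).rootMeasure A =
        ∑' v : G.V, A.indicator 1 (GStarStar.mk (G.addMarks m) o v) := fun m =>
      (lintegral_indicator_one hA).symm.trans (GStar.lintegral_rootMeasure hm)
    rw [h1, lintegral_congr h2,
      lintegral_tsum (f := fun (v : G.V) (m : G.V → M) =>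
        A.indicator (1 : GStarStar (Ξ × M) Θ → ℝ≥0∞) (GStarStar.mk (G.addMarks m) o v))
        fun v => (hm.comp (measurable_mk_addMarks₂ G o v)).aemeasurable]
    refine tsum_congr fun v => ?_
    rw [markLaw₂_apply p G o v hA]
    exact lintegral_indicator_one (measurable_mk_addMarks₂ G o v hA)

/-- Adding i.i.d. marks preserves unimodularity. -/
theorem IsUnimodular.bind_markLaw (p : Measure M) [IsProbabilityMeasure p]
    {μ : Measure (GStar Ξ Θ)} (h : IsUnimodular μ) : IsUnimodular (μ.bind (markLaw p)) := by
  obtain ⟨hμ, hs⟩ := isUnimodular_iff.1 h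
  have hr := GStar.measurable_rootMeasure (Ξ := Ξ) (Θ := Θ)
  have hr' := GStar.measurable_rootMeasure (Ξ := Ξ × M) (Θ := Θ)
  have hm := measurable_markLaw (Ξ := Ξ) (Θ := Θ) p
  have hm₂ := measurable_markLaw₂ (Ξ := Ξ) (Θ := Θ) p
  have hsw := (GStarStar.continuous_swap (Ξ := Ξ) (Θ := Θ)).measurable
  have hsw' := (GStarStar.continuous_swap (Ξ := Ξ × M) (Θ := Θ)).measurable
  -- The symmetric measure of the unmarked network is pushed through a kernel that commutes with
  -- swapping the roots.
  have key : (μ.bind (markLaw p)).bind GStar.rootMeasure =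
      (μ.bind GStar.rootMeasure).bind (markLaw₂ p) := by
    rw [Measure.bind_bind hm.aemeasurable hr'.aemeasurable,
      Measure.bind_bind hr.aemeasurable hm₂.aemeasurable]
    exact congrArg _ (funext fun x => markLaw_bind_rootMeasure p x)
  refine isUnimodular_iff.2 ⟨⟨?_⟩, ?_⟩
  · rw [Measure.bind_apply MeasurableSet.univ hm.aemeasurable]
    simp
  · rw [key]
    ext A hA
    rw [Measure.map_apply hsw' hA, Measure.bind_apply (hsw' hA) hm₂.aemeasurable]
    nth_rewrite 2 [← hs]
    rw [Measure.bind_apply hA hm₂.aemeasurable,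
      lintegral_map (f := fun x => markLaw₂ p x A) ((Measure.measurable_coe hA).comp hm₂) hsw]
    refine lintegral_congr fun x => ?_
    rw [markLaw₂_swap, Measure.map_apply hsw' hA]

end MarkLaw

/-! ### Consequences of mass transport. -/

section Unimodular

open Network Filter

variable {Ξ Θ : Type*}

theorem GStar.isInfinite_mk {G : Network Ξ Θ} {o : G.V} :
    (GStar.mk G o).IsInfinite ↔ Infinite G.V := by
  refine ⟨fun h => h G o rfl, fun h H p hp => ?_⟩
  obtain ⟨φ, -⟩ := GStar.exists_iso hp
  exact Infinite.of_injective _ φ.vMap.symm.injective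

/-- The class `[G, v]` for `[G, o, v]`. -/
def GStarStar.snd (y : GStarStar Ξ Θ) : GStar Ξ Θ := y.swap.fst

@[simp] theorem GStarStar.snd_mk (G : Network Ξ Θ) (o v : G.V) :
    (GStarStar.mk G o v).snd = GStar.mk G v := rfl

variable [MetricSpace Ξ] [MetricSpace Θ]

theorem GStarStar.measurable_snd : Measurable (GStarStar.snd (Ξ := Ξ) (Θ := Θ)) :=
  (GStarStar.continuous_fst.comp GStarStar.continuous_swap).measurable

theorem GStar.measurableSet_isInfinite : MeasurableSet {x : GStar Ξ Θ | x.IsInfinite} := by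
  have : {x : GStar Ξ Θ | x.IsInfinite} = {x | x.rootMeasure univ = ∞} := by
    ext x
    induction x using GStar.ind with
    | h G o =>
      rw [mem_ofPred_eq, mem_ofPred_eq, GStar.isInfinite_mk, ← lintegral_one,
        GStar.lintegral_rootMeasure measurable_const, ENNReal.tsum_const]
      simp
  rw [this]
  exact (Measure.measurable_coe MeasurableSet.univ).comp GStar.measurable_rootMeasure
    (measurableSet_singleton ∞)

theorem IsUnimodular.lintegral_rootMeasure {μ : Measure (GStar Ξ Θ)} (h : IsUnimodular μ)
    {g : GStarStar Ξ Θ → ℝ≥0∞} (hg : Measurable g) :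
    ∫⁻ x, ∫⁻ y, g y ∂x.rootMeasure ∂μ = ∫⁻ x, ∫⁻ y, g y.swap ∂x.rootMeasure ∂μ := by
  have hr := GStar.measurable_rootMeasure (Ξ := Ξ) (Θ := Θ)
  have hs := (GStarStar.continuous_swap (Ξ := Ξ) (Θ := Θ)).measurable
  rw [← Measure.lintegral_bind hr.aemeasurable hg.aemeasurable, ← (isUnimodular_iff.1 h).2,
    lintegral_map hg hs]
  exact Measure.lintegral_bind (f := fun y : GStarStar Ξ Θ => g y.swap) hr.aemeasurable
    (hg.comp hs).aemeasurable

/-- A property that holds a.s. at the root holds a.s. at all vertices. -/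
theorem IsUnimodular.ae_forall_vertices {μ : Measure (GStar Ξ Θ)} (h : IsUnimodular μ)
    {q : GStar Ξ Θ → Prop} (hq : ∀ᵐ x ∂μ, q x) :
    ∀ᵐ x ∂μ, ∀ (G : Network Ξ Θ) (o : G.V), GStar.mk G o = x → ∀ v, q (GStar.mk G v) := by
  obtain ⟨N, hN, hNm, hN0⟩ := exists_measurable_superset_of_null (ae_iff.1 hq)
  have hg : Measurable fun y : GStarStar Ξ Θ => N.indicator (1 : GStar Ξ Θ → ℝ≥0∞) y.snd :=
    (measurable_one.indicator hNm).comp GStarStar.measurable_snd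
  have hs := (GStarStar.continuous_swap (Ξ := Ξ) (Θ := Θ)).measurable
  -- Every vertex sends mass `1` to each vertex in the null set; a root outside the null set
  -- receives nothing.
  have h0 : ∫⁻ x, ∫⁻ y : GStarStar Ξ Θ, N.indicator 1 y.snd ∂x.rootMeasure ∂μ = 0 := by
    rw [h.lintegral_rootMeasure hg]
    refine lintegral_eq_zero_of_ae_eq_zero ?_
    filter_upwards [measure_eq_zero_iff_ae_notMem.1 hN0] with x
    induction x using GStar.ind with
    | h G o =>
      intro hx
      exact (GStar.lintegral_rootMeasure (hg.comp hs)).trans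
        (ENNReal.tsum_eq_zero.2 fun v => indicator_of_notMem hx _)
  have hm : Measurable fun x : GStar Ξ Θ =>
      ∫⁻ y : GStarStar Ξ Θ, N.indicator 1 y.snd ∂x.rootMeasure :=
    (Measure.measurable_lintegral hg).comp GStar.measurable_rootMeasure
  filter_upwards [(lintegral_eq_zero_iff hm).1 h0] with x hx G o hGo v
  subst hGo
  have hx' : ∑' v, N.indicator (1 : GStar Ξ Θ → ℝ≥0∞) (GStar.mk G v) = 0 :=
    (GStar.lintegral_rootMeasure (G := G) (o := o) hg).symm.trans hx
  have hv : GStar.mk G v ∉ N := fun hv => by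
    simpa [hv] using ENNReal.tsum_eq_zero.1 hx' v
  by_contra hc
  exact hv (hN hc)

/-- In an infinite unimodular network one cannot select a finite nonempty set of vertices. -/
theorem IsUnimodular.ae_notMem_of_finite {μ : Measure (GStar Ξ Θ)} (h : IsUnimodular μ)
    {B : Set (GStar Ξ Θ)} (hB : MeasurableSet B)
    (hfin : ∀ G : Network Ξ Θ, {v | GStar.mk G v ∈ B}.Finite) :
    ∀ᵐ x ∂μ, x.IsInfinite → x ∉ B := by
  have := h.1
  have hs := (GStarStar.continuous_swap (Ξ := Ξ) (Θ := Θ)).measurable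
  have hf := (GStarStar.continuous_fst (Ξ := Ξ) (Θ := Θ)).measurable
  have hi : Measurable (B.indicator (1 : GStar Ξ Θ → ℝ≥0∞)) := measurable_one.indicator hB
  have hg₁ : Measurable fun y : GStarStar Ξ Θ => B.indicator (1 : GStar Ξ Θ → ℝ≥0∞) y.snd :=
    hi.comp GStarStar.measurable_snd
  set N : GStar Ξ Θ → ℝ≥0∞ := fun x =>
    ∫⁻ y : GStarStar Ξ Θ, B.indicator 1 y.snd ∂x.rootMeasure with hN
  have hNm : Measurable N := (Measure.measurable_lintegral hg₁).comp GStar.measurable_rootMeasure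
  have hNmk : ∀ (G : Network Ξ Θ) (o : G.V), N (GStar.mk G o) =
      ∑' v, B.indicator (1 : GStar Ξ Θ → ℝ≥0∞) (GStar.mk G v) := fun G o =>
    GStar.lintegral_rootMeasure hg₁
  -- Every vertex spreads mass at most `1` uniformly over the `N` selected vertices. If `N = 0` the
  -- inverse is `∞`, but all indicators vanish and nothing is sent.
  set g : GStarStar Ξ Θ → ℝ≥0∞ := fun y => B.indicator 1 y.snd * (N y.fst)⁻¹
  have hg : Measurable g := hg₁.mul (hNm.comp hf).inv
  have hout : ∫⁻ x, ∫⁻ y, g y ∂x.rootMeasure ∂μ ≤ 1 := by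
    refine (lintegral_mono fun x => ?_).trans_eq (lintegral_one.trans measure_univ)
    change _ ≤ (1 : ℝ≥0∞)
    induction x using GStar.ind with
    | h G o =>
      rw [GStar.lintegral_rootMeasure hg]
      change ∑' v, B.indicator (1 : GStar Ξ Θ → ℝ≥0∞) (GStar.mk G v) * (N (GStar.mk G o))⁻¹ ≤ 1
      rw [ENNReal.tsum_mul_right, ← hNmk G o]
      exact ENNReal.mul_inv_le_one _
  have hin : ∫⁻ x, ∫⁻ y, g y.swap ∂x.rootMeasure ∂μ ≠ ∞ := by
    rw [← h.lintegral_rootMeasure hg]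
    exact (hout.trans_lt ENNReal.one_lt_top).ne
  have hm : Measurable fun x : GStar Ξ Θ => ∫⁻ y, g y.swap ∂x.rootMeasure :=
    (Measure.measurable_lintegral (hg.comp hs)).comp GStar.measurable_rootMeasure
  filter_upwards [ae_lt_top hm hin] with x
  induction x using GStar.ind with
  | h G o =>
    intro hx hinf hxB
    have : Infinite G.V := GStar.isInfinite_mk.1 hinf
    have hx' : ∑' v, B.indicator (1 : GStar Ξ Θ → ℝ≥0∞) (GStar.mk G o) *
        (N (GStar.mk G v))⁻¹ < ∞ :=
      (GStar.lintegral_rootMeasure (G := G) (o := o) (hg.comp hs)).symm.trans_lt hx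
    have hNo : N (GStar.mk G o) ≠ ∞ := by
      rw [hNmk, tsum_eq_sum (s := (hfin G).toFinset) fun v hv => indicator_of_notMem
        (by simpa using hv) _]
      refine (ENNReal.sum_lt_top.2 fun v _ => ?_).ne
      exact (indicator_le_self _ _ _).trans_lt ENNReal.one_lt_top
    have hNv : ∀ v, N (GStar.mk G v) = N (GStar.mk G o) := fun v => by rw [hNmk, hNmk]
    -- A selected root would receive the same positive amount from each of infinitely many vertices,
    -- against the finite expectation.
    simp only [hNv, indicator_of_mem hxB, Pi.one_apply, one_mul] at hx'
    rw [ENNReal.tsum_const_eq_top_of_ne_zero (ENNReal.inv_ne_zero.2 hNo)] at hx'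
    exact hx'.ne rfl

end Unimodular

/-! ### The zero-one law and conditional probabilities. -/

section ZeroOne

open Network Filter

variable {Ξ Θ M : Type*} [MetricSpace Ξ] [MetricSpace Θ] [MetricSpace M]
  [TopologicalSpace.SeparableSpace M] [MeasurableSpace M] [BorelSpace M]

theorem IsInvariantEvent.mk_mem_iff {A : Set (GStar Ξ Θ)} (hA : IsInvariantEvent A)
    (G : Network Ξ Θ) (o v : G.V) : GStar.mk G o ∈ A ↔ GStar.mk G v ∈ A :=
  ⟨hA.2 G o v, hA.2 G v o⟩

theorem IsInvariantEvent.markLaw_eq {A : Set (GStar (Ξ × M) Θ)} (hA : IsInvariantEvent A)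
    (p : Measure M) [IsProbabilityMeasure p] (G : Network Ξ Θ) (o v : G.V) :
    markLaw p (GStar.mk G o) A = markLaw p (GStar.mk G v) A := by
  rw [markLaw_apply p G o hA.1, markLaw_apply p G v hA.1]
  exact congrArg _ (ext fun m => hA.mk_mem_iff (G.addMarks m) o v)

open Classical in
/-- Keep the first of two additional marks at distances in `s` from the root, and the second one at
the other distances. -/
noncomputable def selectMark (s : Set ℕ) (k : ℕ) (a : Ξ × (M × M)) : Ξ × M :=
  (a.1, if k ∈ s then a.2.1 else a.2.2)

omit [TopologicalSpace.SeparableSpace M] [MeasurableSpace M] [BorelSpace M] in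
theorem dist_selectMark_le (s : Set ℕ) (k : ℕ) (a b : Ξ × (M × M)) :
    dist (selectMark s k a) (selectMark s k b) ≤ dist a b := by
  unfold selectMark
  simp only [Prod.dist_eq]
  split_ifs
  · exact max_le_max le_rfl (le_max_left _ _)
  · exact max_le_max le_rfl (le_max_right _ _)

/-- The probability that resampling the marks outside the ball of radius `r` affects `A`. -/
noncomputable def ballDefect (p : Measure M) [IsProbabilityMeasure p] (A : Set (GStar (Ξ × M) Θ))
    (r : ℕ) (x : GStar Ξ Θ) : ℝ≥0∞ :=
  markLaw (p.prod p) x (symmDiff (GStar.relabel (selectMark univ) ⁻¹' A)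
    (GStar.relabel (selectMark (Iic r)) ⁻¹' A))

theorem measurableSet_relabel_selectMark {M : Type*} [MetricSpace M]
    {A : Set (GStar (Ξ × M) Θ)} (hA : MeasurableSet A)
    (s : Set ℕ) : MeasurableSet (GStar.relabel (Θ := Θ) (selectMark (Ξ := Ξ) s) ⁻¹' A) :=
  (GStar.continuous_relabel (dist_selectMark_le s)).measurable hA

/-- Encoding both configurations as one mark in `M × M` and the mixing as a continuous relabelling
makes the defect a value of the kernel `markLaw (p.prod p)` at a fixed event. -/
theorem measurable_ballDefect (p : Measure M) [IsProbabilityMeasure p]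
    {A : Set (GStar (Ξ × M) Θ)} (hA : MeasurableSet A) (r : ℕ) :
    Measurable (ballDefect p A r) := by
  have : SecondCountableTopology M := UniformSpace.secondCountable_of_separable M
  exact (Measure.measurable_coe ((measurableSet_relabel_selectMark hA _).symmDiff
    (measurableSet_relabel_selectMark hA _))).comp (measurable_markLaw (p.prod p))

theorem ballDefect_mk (p : Measure M) [IsProbabilityMeasure p]
    {A : Set (GStar (Ξ × M) Θ)} (hA : MeasurableSet A) (r : ℕ) (G : Network Ξ Θ) (o : G.V) :
    ballDefect p A r (GStar.mk G o) =
      resampleDefect p {m | GStar.mk (G.addMarks m) o ∈ A} (G.ball o r) := by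
  have : SecondCountableTopology M := UniformSpace.secondCountable_of_separable M
  rw [ballDefect, markLaw_apply _ _ _ ((measurableSet_relabel_selectMark hA _).symmDiff
    (measurableSet_relabel_selectMark hA _))]
  rfl

/-- The zero-one law for invariant events and i.i.d. marks on infinite unimodular networks. -/
theorem IsUnimodular.ae_markLaw_zero_or_one (p : Measure M) [IsProbabilityMeasure p]
    {μ : Measure (GStar Ξ Θ)} (h : IsUnimodular μ) (hinf : ∀ᵐ x ∂μ, x.IsInfinite)
    {A : Set (GStar (Ξ × M) Θ)} (hA : IsInvariantEvent A) :
    ∀ᵐ x ∂μ, markLaw p x A = 0 ∨ markLaw p x A = 1 := by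
  have hm := measurable_markLaw (Ξ := Ξ) (Θ := Θ) p
  have hA' : IsInvariantEvent Aᶜ := ⟨hA.1.compl, fun G o v ho hv => ho (hA.2 G v o hv)⟩
  -- One third, because the self-independence bound has three defect terms in total.
  set B : ℕ → Set (GStar Ξ Θ) := fun r =>
    {x | ballDefect p A r x < markLaw p x A * markLaw p x Aᶜ / 3}
  have hB : ∀ r, MeasurableSet (B r) := fun r =>
    measurableSet_lt (measurable_ballDefect p hA.1 r)
      ((((Measure.measurable_coe hA.1).comp hm).mul
        ((Measure.measurable_coe hA'.1).comp hm)).div_const 3)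
  have hdist : ∀ (r : ℕ) (G : Network Ξ Θ) (u v : G.V), GStar.mk G u ∈ B r →
      GStar.mk G v ∈ B r → v ∈ G.ball u (2 * r) := by
    intro r G u v hu hv
    by_contra hc
    have hd : Disjoint (G.ball u r) (G.ball v r) := by
      refine disjoint_left.2 fun w hwu hwv => hc (mem_ball.2 ?_)
      have h1 := G.skeleton_connected.dist_triangle (u := u) (v := w) (w := v)
      have h2 := mem_ball.1 hwu
      have h3 := mem_ball.1 hwv
      rw [SimpleGraph.dist_comm] at h3
      omega
    have hAm := measurable_mk_addMarks (M := M) G u hA.1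
    -- By invariance the defects at `u` and `v` concern the same set of mark configurations.
    have hset : {m : G.V → M | GStar.mk (G.addMarks m) v ∈ A} =
        {m | GStar.mk (G.addMarks m) u ∈ A} := ext fun m => hA.mk_mem_iff (G.addMarks m) v u
    have hle := mul_compl_le_resampleDefect p hAm hd
    simp only [B, mem_ofPred_eq, ballDefect_mk p hA.1, hset, hA.markLaw_eq p G v u,
      hA'.markLaw_eq p G v u] at hu hv
    rw [two_mul] at hle
    refine hle.not_gt ((ENNReal.add_lt_add hu (ENNReal.add_lt_add hv hv)).trans_eq ?_)
    rw [← add_assoc, ENNReal.add_thirds, markLaw_apply p G u hA.1, markLaw_apply p G u hA'.1]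
    rfl
  have hnot : ∀ᵐ x ∂μ, ∀ r, x.IsInfinite → x ∉ B r := ae_all_iff.2 fun r =>
    h.ae_notMem_of_finite (hB r) fun G => by
      rcases {v | GStar.mk G v ∈ B r}.eq_empty_or_nonempty with he | ⟨u, hu⟩
      · simp [he]
      · exact (G.finite_ball u (2 * r)).subset fun v hv => hdist r G u v hu hv
  filter_upwards [hnot, hinf] with x hx hxi
  have hzero : markLaw p x A * markLaw p x Aᶜ = 0 := by
    by_contra hne
    induction x using GStar.ind with
    | h G o =>
      obtain ⟨r, hr⟩ := exists_resampleDefect_lt p (measurable_mk_addMarks (M := M) G o hA.1)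
        (G.ball_mono o) (G.iUnion_ball o)
        (ENNReal.div_ne_zero.2 ⟨hne, by simp⟩ :
          markLaw p (GStar.mk G o) A * markLaw p (GStar.mk G o) Aᶜ / 3 ≠ 0)
      exact hx r hxi ((ballDefect_mk p hA.1 r G o).trans_lt hr)
  exact (mul_eq_zero.1 hzero).imp_right (prob_compl_eq_zero_iff hA.1).1

variable {Ω : Type*} [MeasurableSpace Ω] {P : Measure Ω} [IsProbabilityMeasure P]
  {p : Measure M} [IsProbabilityMeasure p] {X : Ω → GStar Ξ Θ} {X' : Ω → GStar (Ξ × M) Θ}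

omit [IsProbabilityMeasure P] in
theorem IsIIDMarking.map_eq (h : IsIIDMarking p P X X') :
    P.map X' = (P.map X).bind (markLaw p) := by
  obtain ⟨hX, hX', hXX'⟩ := h
  have hm := measurable_markLaw (Ξ := Ξ) (Θ := Θ) p
  ext A hA
  have := hXX' univ A MeasurableSet.univ hA
  rw [Measure.map_apply hX' hA, Measure.bind_apply hA hm.aemeasurable,
    lintegral_map (f := fun x => markLaw p x A) ((Measure.measurable_coe hA).comp hm) hX]
  simpa using this

theorem IsIIDMarking.condExp_ae_eq (h : IsIIDMarking p P X X') {A : Set (GStar (Ξ × M) Θ)}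
    (hA : MeasurableSet A) : (fun ω => (markLaw p (X ω) A).toReal) =ᵐ[P]
      P⟦X' ⁻¹' A | MeasurableSpace.comap X inferInstance⟧ := by
  obtain ⟨hX, hX', hXX'⟩ := h
  have hh : Measurable fun x : GStar Ξ Θ => (markLaw p x A).toReal :=
    ((Measure.measurable_coe hA).comp (measurable_markLaw p)).ennreal_toReal
  have hint : Integrable (fun ω => (markLaw p (X ω) A).toReal) P :=
    Integrable.of_bound (hh.comp hX).aestronglyMeasurable 1
      (Eventually.of_forall fun ω => by
        rw [Real.norm_of_nonneg ENNReal.toReal_nonneg]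
        exact ENNReal.toReal_le_of_le_ofReal zero_le_one (by simpa using prob_le_one))
  refine ae_eq_condExp_of_forall_setIntegral_eq hX.comap_le
    ((integrable_const (1 : ℝ)).indicator (hX' hA)) (fun _ _ _ => hint.integrableOn) ?_
    (hh.comp (comap_measurable X)).stronglyMeasurable.aestronglyMeasurable
  rintro _ ⟨B, hB, rfl⟩ -
  have hmX : Measurable fun ω => markLaw p (X ω) A :=
    ((Measure.measurable_coe hA).comp (measurable_markLaw p)).comp hX
  rw [integral_toReal hmX.aemeasurable (Eventually.of_forall fun ω => measure_lt_top _ _),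
    ← hXX' B A hB hA, setIntegral_indicator (hX' hA)]
  simp [Measure.real]

end ZeroOne

/-! ### The main theorem. -/

theorem mainTheorem9 {Ξ Θ M : Type*}
    [MetricSpace Ξ] [CompleteSpace Ξ] [TopologicalSpace.SeparableSpace Ξ]
    [MetricSpace Θ] [CompleteSpace Θ] [TopologicalSpace.SeparableSpace Θ]
    [MetricSpace M] [CompleteSpace M] [TopologicalSpace.SeparableSpace M]
    [MeasurableSpace M] [BorelSpace M] (p : Measure M) [IsProbabilityMeasure p]
    {Ω : Type*} [MeasurableSpace Ω] (P : Measure Ω) [IsProbabilityMeasure P]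
    (X : Ω → GStar Ξ Θ) (X' : Ω → GStar (Ξ × M) Θ)
    (hmark : IsIIDMarking p P X X')
    (hunimod : IsUnimodular (P.map X))
    (hinf : ∀ᵐ ω ∂P, (X ω).IsInfinite) :
    (∀ A : Set (GStar (Ξ × M) Θ), IsInvariantEvent A →
      (∀ᵐ ω ∂P, (P⟦X' ⁻¹' A | MeasurableSpace.comap X inferInstance⟧) ω = 0 ∨
        (P⟦X' ⁻¹' A | MeasurableSpace.comap X inferInstance⟧) ω = 1) ∧
      (∃ f : GStar Ξ Θ → ℝ, Measurable f ∧
        (fun ω => f (X ω)) =ᵐ[P] P⟦X' ⁻¹' A | MeasurableSpace.comap X inferInstance⟧) ∧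
      ∀ f : GStar Ξ Θ → ℝ, Measurable f →
        (fun ω => f (X ω)) =ᵐ[P] P⟦X' ⁻¹' A | MeasurableSpace.comap X inferInstance⟧ →
        ∀ᵐ ω ∂P, RootIndependentAt f (X ω)) ∧
    (IsExtremal (P.map X) →
      IsExtremal (P.map X') ∧ ∀ᵐ ω ∂P, (X' ω).IsInfinite) := by
  have hX := hmark.1
  have hX' := hmark.2.1
  have hm := measurable_markLaw (Ξ := Ξ) (Θ := Θ) p
  have hinf' : ∀ᵐ x ∂P.map X, x.IsInfinite :=
    (ae_map_iff hX.aemeasurable GStar.measurableSet_isInfinite).2 hinf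
  have h01 : ∀ A : Set (GStar (Ξ × M) Θ), IsInvariantEvent A →
      ∀ᵐ x ∂P.map X, markLaw p x A = 0 ∨ markLaw p x A = 1 := fun A hA =>
    hunimod.ae_markLaw_zero_or_one p hinf' hA
  refine ⟨fun A hA => ?_, fun hext => ⟨⟨?_, fun A hA => ?_⟩, ?_⟩⟩
  · have hh : Measurable fun x : GStar Ξ Θ => (markLaw p x A).toReal :=
      ((Measure.measurable_coe hA.1).comp hm).ennreal_toReal
    have hcond := hmark.condExp_ae_eq hA.1
    refine ⟨?_, ⟨_, hh, hcond⟩, fun f hf hfc => ?_⟩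
    · filter_upwards [ae_of_ae_map hX.aemeasurable (h01 A hA), hcond] with ω h hω
      rw [← hω]
      rcases h with h | h <;> simp [h]
    -- Any version agrees a.s. with the canonical one at the root, hence by unimodularity at all
    -- vertices simultaneously, and the canonical one is root-independent everywhere.
    · have hfh : ∀ᵐ x ∂P.map X, f x = (markLaw p x A).toReal :=
        (ae_map_iff hX.aemeasurable (measurableSet_eq_fun hf hh)).2 (hfc.trans hcond.symm)
      refine (ae_of_ae_map hX.aemeasurable (hunimod.ae_forall_vertices hfh)).mono
        fun ω hω G o hGo v => ?_
      rw [hω G o hGo v, ← hGo, hω G o hGo o, hA.markLaw_eq p G v o]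
  · rw [hmark.map_eq]
    exact hunimod.bind_markLaw p
  · have hI : IsInvariantEvent {x : GStar Ξ Θ | markLaw p x A = 1} :=
      ⟨(Measure.measurable_coe hA.1).comp hm (measurableSet_singleton 1),
        fun G o v ho => (hA.markLaw_eq p G v o).trans ho⟩
    -- By the zero-one law the conditional probability of `A` is a.s. the indicator of this
    -- invariant set.
    have hval : P.map X' A = P.map X {x : GStar Ξ Θ | markLaw p x A = 1} := by
      rw [hmark.map_eq, Measure.bind_apply hA.1 hm.aemeasurable,
        ← lintegral_indicator_one hI.1]
      refine lintegral_congr_ae ((h01 A hA).mono fun x hx => ?_)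
      rcases hx with hx | hx <;> simp [indicator, hx]
    rw [hval]
    exact hext.2 _ hI
  · have hMinf := GStar.measurableSet_isInfinite (Ξ := Ξ × M) (Θ := Θ)
    refine (ae_map_iff hX'.aemeasurable hMinf).1 ?_
    rw [hmark.map_eq]
    refine mem_ae_iff.2 ?_
    change (P.map X).bind (markLaw p) ({x : GStar (Ξ × M) Θ | x.IsInfinite}ᶜ) = 0
    rw [Measure.bind_apply hMinf.compl hm.aemeasurable]
    refine lintegral_eq_zero_of_ae_eq_zero (hinf'.mono fun x => ?_)
    induction x using GStar.ind with
    | h G o =>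
      intro hx
      have hV : Infinite G.V := GStar.isInfinite_mk.1 hx
      have : ∀ m : G.V → M, (GStar.mk (G.addMarks m) o).IsInfinite := fun m =>
        GStar.isInfinite_mk.2 hV
      refine (markLaw_apply p G o hMinf.compl).trans ?_
      simp [this]
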